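/- Let $T>0$ and let $f\colon[0,T]\times\mathbb{R}^n\to\mathbb{R}$. Write $\nabla_x f$ and $\nabla_x^2 f$ for the gradient and the Hessian matrix of $f$ with respect to $x$, $f_t$ for its time derivative, and $$Z_f=\{(t,\xi)\in[0,T]\times\mathbb{R}^n:\ \nabla_x f(t,\xi)=0,\ \det\nabla_x^2 f(t,\xi)=0\}.$$ Assume: 1. $f$ is of class $C^3$ and there are $a_0\ge 0$, $c_0>0$ with $\nabla_x f(t,x)\cdot x\ge c_0|x|^2-a_0$ for all $(t,x)\in[0,T]\times\mathbb{R}^n$. 2. $Z_f$ is finite, the projection $(t,\xi)\mapsto t$ is injective on $Z_f$, and no point of $Z_f$ has $t=0$ or $t=T$. 3. For every $(\tau,\xi)\in Z_f$ with $\nabla_x^2 f(\tau,\xi)$ positive semidefinite there is $\ell\in\mathbb{R}^n\setminus\{0\}$ such that (a) $\ker\nabla_x^2 f(\tau,\xi)=\mathrm{span}(\ell)$; (b) $\nabla_x f_t(\tau,\xi)\cdot\ell\ne 0$; (c) $\sum_{i,j,k}f_{x_ix_jx_k}(\tau,\xi)\,\ell_i\ell_j\ell_k\neq 0$. 4. For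 every $(\tau,\xi)\in Z_f$ with $\nabla_x^2 f(\tau,\xi)$ positive semidefinite and satisfying (a) and (c) for some $\ell\neq0$: if $w\colon\mathbb{R}\to\mathbb{R}^n$ is a solution of $\dot w(s)=-\nabla_x f(\tau,w(s))$, not identically equal to $\xi$, with $w(s)\to\xi$ as $s\to-\infty$ and $w(s)\to w_\infty$ as $s\to+\infty$, then $\nabla_x^2 f(\tau,w_\infty)$ is positive definite. Let $y_0\in\mathbb{R}^n$ be such that $\nabla_x f(0,y_0)=0$ and $\nabla_x^2 f(0,y_0)$ is positive definite. Then there exist a unique $k\geq 1$, a unique finite family of times $0=t_0<t_1<\dots<t_k=T$, a unique family of functions $u_i\colon[t_{i-1},t_i[\to\mathbb{R}^n$ of class $C^2$, $i=1,\dots,k$, and a unique (each up to a time translation) family of functions $v_i\colon\mathbb{R}\to\mathbb{R}^n$ of class $C^2$, $i=1,\dots,k-1$, such that all of the following hold: (1) $u_1(0)=y_0$; (2) for every $i=1,\dots,k$ and $t\in[t_{i-1},t_i[$, $\nabla_x f(t,u_i(t))=0$ and $\nabla_x^2 f(t,u_i(t))$ is positive definite; (3) for every $i=1,\dots,k$ the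 limit $x_i:=\lim_{t\to t_i^-}u_i(t)$ exists, and for every $i=1,\dots,k-1$, $(t_i,x_i)\in Z_f$, $\nabla_x^2 f(t_i,x_i)$ is positive semidefinite, and, for $\ell$ spanning its (one-dimensional) kernel, the numbers $\nabla_x f_t(t_i,x_i)\cdot\ell$ and $\sum_{j,l,m}f_{x_jx_lx_m}(t_i,x_i)\,\ell_j\ell_l\ell_m$ are nonzero and have the same sign; (4) for every $i=1,\dots,k-1$, $\dot v_i(s)=-\nabla_x f(t_i,v_i(s))$ for all $s\in\mathbb{R}$, $\lim_{s\to-\infty}v_i(s)=x_i$ and $\lim_{s\to+\infty}v_i(s)=u_{i+1}(t_i)$. -/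

import Mathlib

open Set Filter Topology

noncomputable section

namespace GradFlow

/-- `ℝⁿ` with the Euclidean norm. -/
abbrev Rn (n : ℕ) : Type := EuclideanSpace ℝ (Fin n)

variable {n : ℕ}

/-- The partial derivative `g_{x_i}` of a function on `ℝⁿ`. -/
def pderiv (i : Fin n) (g : Rn n → ℝ) (x : Rn n) : ℝ :=
  fderiv ℝ g x (EuclideanSpace.single i 1)

/-- The Hessian matrix `(g_{x_i x_j}(x))_{ij}`. -/
def hessian (g : Rn n → ℝ) (x : Rn n) : Matrix (Fin n) (Fin n) ℝ :=
  Matrix.of fun i j => pderiv j (pderiv i g) x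

/-- The cubic form `∑_{i,j,k} g_{x_i x_j x_k}(x) ℓ_i ℓ_j ℓ_k`. -/
def cubicForm (g : Rn n → ℝ) (x ℓ : Rn n) : ℝ :=
  ∑ i, ∑ j, ∑ k, pderiv k (pderiv j (pderiv i g)) x * ℓ i * ℓ j * ℓ k

/-- The time derivative `f_t(t, x)` of `f : [0, T] × ℝⁿ → ℝ` (one-sided at `t = 0` and `t = T`). -/
def timeDeriv (T : ℝ) (f : ℝ → Rn n → ℝ) (t : ℝ) (x : Rn n) : ℝ :=
  derivWithin (fun s => f s x) (Icc 0 T) t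

/-- The quantity `∇_x f_t(t, x) · ℓ`. -/
def mixedForm (T : ℝ) (f : ℝ → Rn n → ℝ) (t : ℝ) (x ℓ : Rn n) : ℝ :=
  inner ℝ (gradient (timeDeriv T f t) x) ℓ

/-- The set of pairs `(t, x)` in `[0, T] × ℝⁿ` such that `x` is a critical point of `f(t, ·)`. -/
def criticalSet (T : ℝ) (f : ℝ → Rn n → ℝ) : Set (ℝ × Rn n) :=
  {p | p.1 ∈ Icc 0 T ∧ gradient (f p.1) p.2 = 0}

/-- The set of pairs `(t, ξ)` such that `ξ` is a degenerate critical point of `f(t, ·)`. -/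
def degenerateSet (T : ℝ) (f : ℝ → Rn n → ℝ) : Set (ℝ × Rn n) :=
  {p | p ∈ criticalSet T f ∧ (hessian (f p.1) p.2).det = 0}

/-- `ℓ` is nonzero and spans the kernel of the Hessian matrix of `g` at `x`. -/
def SpansKernel (g : Rn n → ℝ) (x ℓ : Rn n) : Prop :=
  ℓ ≠ 0 ∧ LinearMap.ker (Matrix.toEuclideanLin (hessian g x)) = Submodule.span ℝ {ℓ}

/-- `w : ℝ → ℝⁿ` solves the autonomous gradient flow `w' = -∇g(w)` on the whole line. -/
def IsGradientFlow (g : Rn n → ℝ) (w : ℝ → Rn n) : Prop :=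
  ∀ s, HasDerivAt w (-gradient g (w s)) s

/-- Regularity and coercivity: `f` is `C³` on `[0, T] × ℝⁿ` and
`∇_x f(t, x) · x ≥ c₀ |x|² - a₀` for some `c₀ > 0`, `a₀ ≥ 0`. -/
def SmoothCoercive (T : ℝ) (f : ℝ → Rn n → ℝ) : Prop :=
  ContDiffOn ℝ 3 (Function.uncurry f) (Icc 0 T ×ˢ univ) ∧
  ∃ a₀ c₀ : ℝ, 0 ≤ a₀ ∧ 0 < c₀ ∧
    ∀ t ∈ Icc 0 T, ∀ x : Rn n, c₀ * ‖x‖ ^ 2 - a₀ ≤ inner ℝ (gradient (f t) x) x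

/-- There are finitely many degenerate critical pairs, at most one at each time, and none at the
times `0` and `T`. -/
def FinitelyDegenerate (T : ℝ) (f : ℝ → Rn n → ℝ) : Prop :=
  (degenerateSet T f).Finite ∧
  InjOn Prod.fst (degenerateSet T f) ∧
  0 ∉ Prod.fst '' degenerateSet T f ∧ T ∉ Prod.fst '' degenerateSet T f

/-- At each degenerate critical point with positive semidefinite Hessian, the kernel of the Hessian
is a line and the two transversality conditions hold. -/
def Transversal (T : ℝ) (f : ℝ → Rn n → ℝ) : Prop :=
  ∀ τ ξ, (τ, ξ) ∈ degenerateSet T f → (hessian (f τ) ξ).PosSemidef →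
    ∃ ℓ, SpansKernel (f τ) ξ ℓ ∧ mixedForm T f τ ξ ℓ ≠ 0 ∧ cubicForm (f τ) ξ ℓ ≠ 0

/-- Every heteroclinic orbit issuing from a degenerate critical point with positive semidefinite
Hessian, one-dimensional kernel and nonzero cubic term ends at a point with positive definite
Hessian. The stationary solution `w ≡ ξ` is not a heteroclinic orbit. -/
def HeteroclinicEndsNondegenerate (T : ℝ) (f : ℝ → Rn n → ℝ) : Prop :=
  ∀ τ ξ, (τ, ξ) ∈ degenerateSet T f → (hessian (f τ) ξ).PosSemidef →
    (∃ ℓ, SpansKernel (f τ) ξ ℓ ∧ cubicForm (f τ) ξ ℓ ≠ 0) →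
    ∀ (w : ℝ → Rn n) (w_inf : Rn n), IsGradientFlow (f τ) w → (∃ s, w s ≠ ξ) →
      Tendsto w atBot (𝓝 ξ) → Tendsto w atTop (𝓝 w_inf) →
      (hessian (f τ) w_inf).PosDef

/-- The conditions on the times `0 = t 0 < ⋯ < t k = T`, the branches `u`, their left limits `x` and
the connecting orbits `v`. Indices start from `0`: the branch `u i` lives on `[t i, t (i+1))`
for `i < k`, its limit at `t (i+1)` is `x i`, and for `i + 1 < k` the orbit `v i` goes from `x i`
to `u (i+1) (t (i+1))` at the frozen time `t (i+1)`. Values at other indices, and of `u i` outside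
`[t i, t (i+1))`, are irrelevant. -/
structure IsEvolution (T : ℝ) (f : ℝ → Rn n → ℝ) (y₀ : Rn n)
    (k : ℕ) (t : ℕ → ℝ) (u : ℕ → ℝ → Rn n) (x : ℕ → Rn n) (v : ℕ → ℝ → Rn n) : Prop where
  pos : 0 < k
  t_zero : t 0 = 0
  t_last : t k = T
  t_lt : ∀ i < k, t i < t (i + 1)
  u_contDiff : ∀ i < k, ContDiffOn ℝ 2 (u i) (Ico (t i) (t (i + 1)))
  v_contDiff : ∀ i, i + 1 < k → ContDiff ℝ 2 (v i)
  u_init : u 0 0 = y₀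
  u_critical : ∀ i < k, ∀ s ∈ Ico (t i) (t (i + 1)), gradient (f s) (u i s) = 0
  u_posDef : ∀ i < k, ∀ s ∈ Ico (t i) (t (i + 1)), (hessian (f s) (u i s)).PosDef
  u_limit : ∀ i < k, Tendsto (u i) (𝓝[<] t (i + 1)) (𝓝 (x i))
  x_degenerate : ∀ i, i + 1 < k → (t (i + 1), x i) ∈ degenerateSet T f
  x_posSemidef : ∀ i, i + 1 < k → (hessian (f (t (i + 1))) (x i)).PosSemidef
  x_sameSign : ∀ i, i + 1 < k → ∃ ℓ, SpansKernel (f (t (i + 1))) (x i) ℓ ∧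
    0 < mixedForm T f (t (i + 1)) (x i) ℓ * cubicForm (f (t (i + 1))) (x i) ℓ
  v_flow : ∀ i, i + 1 < k → IsGradientFlow (f (t (i + 1))) (v i)
  v_atBot : ∀ i, i + 1 < k → Tendsto (v i) atBot (𝓝 (x i))
  v_atTop : ∀ i, i + 1 < k → Tendsto (v i) atTop (𝓝 (u (i + 1) (t (i + 1))))

end GradFlow

end

/-!
A nondegenerate branch of critical points is continued in time by the implicit function theorem, and
coercivity keeps it in a fixed ball. Its cluster points at the end of a maximal interval are
critical and form a connected set; at each time there are only countably many critical points
(nondegenerate ones are isolated), so the branch converges, and by maximality its limit is a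
degenerate critical point with positive semidefinite Hessian. As there are finitely many degenerate
points, finitely many jumps suffice to reach `T`.

Near such a limit the flow along the kernel of the Hessian is governed by the cubic term, while the
flow contracts the other directions exponentially: any two orbits leaving the point differ by a
vector in a thin cone around the kernel, hence coincide once they are synchronised along the kernel,
and an orbit leaving the point is a limit of orbits started ever closer to it inside that cone. It
converges forwards in time for the same reason as a branch does. The sign condition holds because,
if the time derivative of the gradient pushed the wrong way along the kernel, no critical point
could survive nearby just before the degenerate time.
-/

noncomputable section

namespace GradFlow

variable {n : ℕ}

section Flow

open scoped Manifold

variable {E : Type*} [NormedAddCommGroup E] [NormedSpace ℝ E] {G : E → E} {w w₁ w₂ : ℝ → E}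

lemma contDiff_of_isIntegralCurve {m : ℕ} (hG : ContDiff ℝ m G)
    (hw : IsIntegralCurve w fun _ => G) : ContDiff ℝ (m + 1) w := by
  have hderiv : deriv w = G ∘ w := funext fun s => (hw s).deriv
  have hdiff : Differentiable ℝ w := fun s => (hw s).differentiableAt
  induction m with
  | zero =>
    rw [contDiff_succ_iff_deriv, hderiv]
    exact ⟨hdiff, by simp, contDiff_zero.2 (hG.continuous.comp hw.continuous)⟩
  | succ m ih =>
    rw [contDiff_succ_iff_deriv, hderiv]
    have hGm : ContDiff ℝ m G := hG.of_le (by exact_mod_cast m.le_succ)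
    exact ⟨hdiff, by simp, hG.comp (by exact_mod_cast ih hGm)⟩

lemma isMIntegralCurveOn_iff_isIntegralCurveOn {s : Set ℝ} :
    IsMIntegralCurveOn (I := 𝓘(ℝ, E)) w G s ↔ IsIntegralCurveOn w (fun _ => G) s :=
  forall₂_congr fun _ _ => hasMFDerivWithinAt_iff_hasFDerivWithinAt

lemma isMIntegralCurve_iff_isIntegralCurve :
    IsMIntegralCurve (I := 𝓘(ℝ, E)) w G ↔ IsIntegralCurve w fun _ => G :=
  forall_congr' fun _ => hasMFDerivAt_iff_hasFDerivAt

lemma eq_of_isIntegralCurve [CompleteSpace E] (hG : ContDiff ℝ 1 G)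
    (h₁ : IsIntegralCurve w₁ fun _ => G) (h₂ : IsIntegralCurve w₂ fun _ => G) {s₀ : ℝ}
    (h : w₁ s₀ = w₂ s₀) : w₁ = w₂ :=
  isMIntegralCurve_Ioo_eq_of_contMDiff_boundaryless (contMDiff_vectorSpace_iff_contDiff.2 hG)
    (isMIntegralCurve_iff_isIntegralCurve.2 h₁) (isMIntegralCurve_iff_isIntegralCurve.2 h₂) h

theorem exists_isIntegralCurve_of_lipschitzWith [CompleteSpace E] (hG : ContDiff ℝ 1 G)
    {K : NNReal} (hK : LipschitzWith K G) (x₀ : E) :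
    ∃ w, w 0 = x₀ ∧ IsIntegralCurve w fun _ => G := by
  obtain ⟨ε, hεpos, hε⟩ : ∃ ε : ℝ, 0 < ε ∧ (1 + K) * ε = 1 :=
    ⟨(1 + K)⁻¹, by positivity, mul_inv_cancel₀ (by positivity)⟩
  have hlocal : ∀ x, ∃ w : ℝ → E, w 0 = x ∧
      IsMIntegralCurveOn (I := 𝓘(ℝ, E)) w G (Ioo (-ε) ε) := by
    intro x
    have hbound : ∀ y ∈ Metric.closedBall x (‖G x‖₊ + 1), ‖G y‖ ≤ (1 + K) * (‖G x‖₊ + 1) := by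
      intro y hy
      have hGy : ‖G y - G x‖ ≤ K * (‖G x‖ + 1) := by
        rw [← dist_eq_norm]
        exact (hK.dist_le_mul y x).trans (by gcongr; exact hy)
      have := norm_le_norm_add_norm_sub' (G y) (G x)
      rw [coe_nnnorm]
      linarith
    have hPL : IsPicardLindelof (fun _ => G) (⟨0, by simp [hεpos.le]⟩ : Icc (-ε) ε) x
        (‖G x‖₊ + 1) 0 ((1 + K) * (‖G x‖₊ + 1)) K := by
      refine .of_time_independent (by exact_mod_cast hbound) hK.lipschitzOnWith ?_
      simp only [sub_zero, zero_sub, neg_neg, max_self, NNReal.coe_zero]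
      refine le_of_eq ?_
      push_cast
      linear_combination (‖G x‖ + 1) * hε
    obtain ⟨w, hw0, hw⟩ := hPL.exists_eq_forall_mem_Icc_hasDerivWithinAt₀
    exact ⟨w, hw0, isMIntegralCurveOn_iff_isIntegralCurveOn.2 fun s hs =>
      (hw s (Ioo_subset_Icc_self hs)).mono Ioo_subset_Icc_self⟩
  obtain ⟨w, hw0, hw⟩ := exists_isMIntegralCurve_of_isMIntegralCurveOn
    (contMDiff_vectorSpace_iff_contDiff.2 hG) hεpos hlocal x₀
  exact ⟨w, hw0, isMIntegralCurve_iff_isIntegralCurve.1 hw⟩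

lemma dist_le_of_isIntegralCurve {K : NNReal} (hK : LipschitzWith K G)
    (h₁ : IsIntegralCurve w₁ fun _ => G) (h₂ : IsIntegralCurve w₂ fun _ => G) (s : ℝ) :
    dist (w₁ s) (w₂ s) ≤ dist (w₁ 0) (w₂ 0) * Real.exp (K * |s|) := by
  wlog hs : 0 ≤ s generalizing G w₁ w₂ s
  · have hreverse : ∀ {w}, (IsIntegralCurve w fun _ => G) →
        IsIntegralCurve (w ∘ (· * -1)) fun _ => -G := fun hw => by
      simpa [Function.comp_def] using! hw.comp_mul (-1)
    simpa using this hK.neg (hreverse h₁) (hreverse h₂) (-s) (by linarith)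
  · simpa [abs_of_nonneg hs] using dist_le_of_trajectories_ODE (v := fun _ => G) (fun _ => hK)
      h₁.continuous.continuousOn (fun t _ => (h₁ t).hasDerivWithinAt)
      h₂.continuous.continuousOn (fun t _ => (h₂ t).hasDerivWithinAt) le_rfl s ⟨hs, le_rfl⟩

theorem exists_subseq_tendsto_isIntegralCurve [CompleteSpace E] (hG : ContDiff ℝ 1 G) {K : NNReal}
    (hK : LipschitzWith K G) {S : Set E} (hS : IsCompact S) {v : ℕ → ℝ → E}
    (hv : ∀ N, IsIntegralCurve (v N) fun _ => G) (hvS : ∀ N, v N 0 ∈ S) :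
    ∃ (w : ℝ → E) (φ : ℕ → ℕ), (IsIntegralCurve w fun _ => G) ∧ StrictMono φ ∧
      ∀ s, Tendsto (fun N => v (φ N) s) atTop (𝓝 (w s)) := by
  obtain ⟨b, -, φ, hφ, hb⟩ := hS.tendsto_subseq hvS
  obtain ⟨w, hw₀, hw⟩ := exists_isIntegralCurve_of_lipschitzWith hG hK b
  refine ⟨w, φ, hw, hφ, fun s => ?_⟩
  have hdist : Tendsto (fun N => dist (v (φ N) 0) (w 0) * Real.exp (K * |s|)) atTop (𝓝 0) := by
    rw [hw₀]
    simpa only [zero_mul, Function.comp_apply] using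
      (tendsto_iff_dist_tendsto_zero.1 hb).mul_const _
  exact tendsto_iff_dist_tendsto_zero.2 <| squeeze_zero (fun _ => dist_nonneg)
    (fun N => dist_le_of_isIntegralCurve hK (hv (φ N)) hw s) hdist

end Flow

section Cluster

variable {X Y : Type*} [TopologicalSpace X] [MetricSpace Y] {l : Filter X} {u : X → Y} {K : Set Y}
  {p q : Y}

lemma frequently_dist_eq_of_mapClusterPt
    (hconn : ∀ A ∈ l, ∃ B ∈ l, B ⊆ A ∧ IsPreconnected B ∧ ContinuousOn u B)
    (hp : MapClusterPt p l u) (hq : MapClusterPt q l u) {c : ℝ} (hc : c ∈ Ioo 0 (dist q p)) :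
    ∃ᶠ s in l, dist (u s) p = c := by
  rw [frequently_iff]
  intro A hA
  obtain ⟨B, hB, hBA, hBc, hBu⟩ := hconn A hA
  obtain ⟨s₁, hs₁, hs₁B⟩ := ((mapClusterPt_iff_frequently.1 hp _
    (Metric.ball_mem_nhds p hc.1)).and_eventually hB).exists
  obtain ⟨s₂, hs₂, hs₂B⟩ := ((mapClusterPt_iff_frequently.1 hq _
    (Metric.ball_mem_nhds q (sub_pos.2 hc.2))).and_eventually hB).exists
  have hfar : c < dist (u s₂) p := by
    have := dist_triangle q (u s₂) p
    rw [Metric.mem_ball, dist_comm] at hs₂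
    linarith
  have hcont : ContinuousOn (fun s => dist (u s) p) B :=
    (continuous_id.dist continuous_const).comp_continuousOn hBu
  obtain ⟨s, hs, hsc⟩ :=
    hBc.intermediate_value hs₁B hs₂B hcont ⟨(Metric.mem_ball.1 hs₁).le, hfar.le⟩
  exact ⟨s, hBA hs, hsc⟩

lemma exists_mapClusterPt_dist_eq (hK : IsCompact K) (huK : ∀ᶠ s in l, u s ∈ K)
    (hconn : ∀ A ∈ l, ∃ B ∈ l, B ⊆ A ∧ IsPreconnected B ∧ ContinuousOn u B)
    (hp : MapClusterPt p l u) (hq : MapClusterPt q l u) {c : ℝ} (hc : c ∈ Ioo 0 (dist q p)) :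
    ∃ x, MapClusterPt x l u ∧ dist x p = c := by
  have hfreq : ∃ᶠ s in l, u s ∈ K ∩ Metric.sphere p c :=
    ((frequently_dist_eq_of_mapClusterPt hconn hp hq hc).and_eventually huK).mono
      fun s hs => ⟨hs.2, hs.1⟩
  obtain ⟨x, hx, hxu⟩ :=
    (hK.inter_right Metric.isClosed_sphere).exists_mapClusterPt_of_frequently hfreq
  exact ⟨x, hxu, hx.2⟩

theorem exists_tendsto_of_countable_mapClusterPt [l.NeBot] (hK : IsCompact K)
    (huK : ∀ᶠ s in l, u s ∈ K)
    (hconn : ∀ A ∈ l, ∃ B ∈ l, B ⊆ A ∧ IsPreconnected B ∧ ContinuousOn u B)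
    (hcount : {x | MapClusterPt x l u}.Countable) :
    ∃ p, Tendsto u l (𝓝 p) := by
  obtain ⟨p, -, hp⟩ := hK.exists_mapClusterPt_of_frequently huK.frequently
  refine ⟨p, hK.tendsto_nhds_of_unique_mapClusterPt huK fun q _ hq => ?_⟩
  by_contra hne
  have hsub : Ioo 0 (dist q p) ⊆ (dist · p) '' {x | MapClusterPt x l u} := fun c hc =>
    exists_mapClusterPt_dist_eq hK huK hconn hp hq hc
  exact (dist_pos.2 hne).not_ge (Cardinal.Real.Ioo_countable_iff.1 ((hcount.image _).mono hsub))

end Cluster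

section GradientDescent

/-- A form of Barbalat's lemma. -/
theorem tendsto_zero_of_hasDerivAt_neg {h φ : ℝ → ℝ} (hderiv : ∀ s, HasDerivAt h (-φ s) s)
    (hφ : ∀ s, 0 ≤ φ s) (hbdd : BddBelow (h '' Ici 0)) (hunif : UniformContinuousOn φ (Ici 0)) :
    Tendsto φ atTop (𝓝 0) := by
  have hanti : Antitone h := antitone_of_hasDerivAt_nonpos hderiv fun s => neg_nonpos.2 (hφ s)
  have hbdd' : BddBelow (range h) := by
    obtain ⟨m, hm⟩ := hbdd
    refine ⟨m, forall_mem_range.2 fun s => ?_⟩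
    exact (hm (mem_image_of_mem h (le_max_right s 0))).trans (hanti (le_max_left s 0))
  rw [Metric.tendsto_atTop]
  intro ε hε
  obtain ⟨δ, hδ, hφδ⟩ := Metric.uniformContinuousOn_iff.1 hunif (ε / 2) (half_pos hε)
  have hdecay : Tendsto (fun s => h s - h (s + δ / 2)) atTop (𝓝 0) := by
    have hlim := tendsto_atTop_ciInf hanti hbdd'
    simpa using hlim.sub (hlim.comp (tendsto_atTop_add_const_right _ (δ / 2) tendsto_id))
  obtain ⟨N, hN⟩ := eventually_atTop.1 ((hdecay.eventually_lt_const
    (show 0 < ε / 2 * (δ / 2) by positivity)).and (eventually_ge_atTop 0))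
  refine ⟨N, fun s hs => ?_⟩
  obtain ⟨hlt, hs₀⟩ := hN s hs
  obtain ⟨r, hr, hslope⟩ := exists_hasDerivAt_eq_slope h (fun s => -φ s)
    (lt_add_of_pos_right s (half_pos hδ))
    (HasDerivAt.continuousOn fun x _ => hderiv x) fun x _ => hderiv x
  have hφr : φ r < ε / 2 := by
    rw [add_sub_cancel_left, eq_div_iff (half_pos hδ).ne'] at hslope
    exact lt_of_mul_lt_mul_right (by linarith) (half_pos hδ).le
  have hφs : dist (φ s) (φ r) < ε / 2 := hφδ s hs₀ r (hs₀.trans hr.1.le) <| by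
    rw [Real.dist_eq, abs_lt]
    constructor <;> linarith [hr.1, hr.2]
  rw [Real.dist_eq] at hφs
  rw [Real.dist_eq, sub_zero, abs_of_nonneg (hφ s)]
  linarith [le_abs_self (φ s - φ r)]

variable {E : Type*} [NormedAddCommGroup E] [InnerProductSpace ℝ E] [CompleteSpace E] {g : E → ℝ}
  {w : ℝ → E} {K : Set E}

lemma hasDerivAt_comp_gradientFlow (hg : Differentiable ℝ g)
    (hw : IsIntegralCurve w fun _ x => -gradient g x) (s : ℝ) :
    HasDerivAt (fun s => g (w s)) (-‖gradient g (w s)‖ ^ 2) s := by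
  have hchain := (hg (w s)).hasGradientAt.hasFDerivAt.comp_hasDerivAt s (hw s)
  simp only [map_neg, InnerProductSpace.toDual_apply_apply, real_inner_self_eq_norm_sq] at hchain
  exact hchain

theorem tendsto_gradient_zero_atTop (hg : Differentiable ℝ g) (hgrad : Continuous (gradient g))
    (hw : IsIntegralCurve w fun _ x => -gradient g x) (hK : IsCompact K)
    (hwK : MapsTo w (Ici 0) K) : Tendsto (fun s => gradient g (w s)) atTop (𝓝 0) := by
  obtain ⟨M, hM⟩ := hK.exists_bound_of_continuousOn hgrad.continuousOn
  have hM₀ : 0 ≤ M := (norm_nonneg _).trans (hM _ (hwK self_mem_Ici))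
  have hlip : LipschitzOnWith ⟨M, hM₀⟩ w (Ici 0) :=
    (convex_Ici 0).lipschitzOnWith_of_nnnorm_hasDerivWithin_le
      (fun s _ => (hw s).hasDerivWithinAt)
      fun s hs => (norm_neg (gradient g (w s))).trans_le (hM _ (hwK hs))
  have hunif : UniformContinuousOn (fun s => ‖gradient g (w s)‖ ^ 2) (Ici 0) :=
    (hK.uniformContinuousOn_of_continuous (hgrad.norm.pow 2).continuousOn).comp
      hlip.uniformContinuousOn hwK
  have hbdd : BddBelow ((fun s => g (w s)) '' Ici 0) :=
    (hK.image hg.continuous).bddBelow.mono <| by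
      rintro _ ⟨s, hs, rfl⟩
      exact mem_image_of_mem g (hwK hs)
  have hsq := tendsto_zero_of_hasDerivAt_neg (hasDerivAt_comp_gradientFlow hg hw)
    (fun s => sq_nonneg _) hbdd hunif
  rw [tendsto_zero_iff_norm_tendsto_zero]
  simpa only [Real.sqrt_sq (norm_nonneg _), Real.sqrt_zero] using hsq.sqrt

theorem exists_critical_tendsto_atTop (hg : Differentiable ℝ g) (hgrad : Continuous (gradient g))
    (hcount : {x | gradient g x = 0}.Countable)
    (hw : IsIntegralCurve w fun _ x => -gradient g x) (hK : IsCompact K)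
    (hwK : MapsTo w (Ici 0) K) : ∃ p, gradient g p = 0 ∧ Tendsto w atTop (𝓝 p) := by
  have hzero := tendsto_gradient_zero_atTop hg hgrad hw hK hwK
  have hcrit : ∀ p, MapClusterPt p atTop w → gradient g p = 0 := by
    intro p hp
    obtain ⟨U, hU, hUp⟩ := mapClusterPt_iff_ultrafilter.1 hp
    exact tendsto_nhds_unique ((hgrad.tendsto p).comp hUp) (hzero.mono_left hU)
  obtain ⟨p, hp⟩ := exists_tendsto_of_countable_mapClusterPt hK
    ((eventually_ge_atTop 0).mono hwK) (fun A hA => by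
      obtain ⟨a, ha⟩ := mem_atTop_sets.1 hA
      exact ⟨Ici a, Ici_mem_atTop a, ha, isPreconnected_Ici, hw.continuous.continuousOn⟩)
    (hcount.mono hcrit)
  exact ⟨p, hcrit p hp.mapClusterPt, hp⟩

end GradientDescent

lemma exists_first_exit {X : Type*} [TopologicalSpace X] {O : Set X} (hO : IsOpen O) {w : ℝ → X}
    (hw : Continuous w) (hw₀ : w 0 ∈ O) (hexit : ∃ s, 0 ≤ s ∧ w s ∉ O) :
    ∃ T, 0 ≤ T ∧ w T ∉ O ∧ ∀ s ∈ Icc 0 T, w s ∈ closure O := by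
  set A : Set ℝ := Ici 0 ∩ w ⁻¹' Oᶜ
  have hbdd : BddBelow A := ⟨0, fun s hs => hs.1⟩
  have hmem : sInf A ∈ A :=
    (isClosed_Ici.inter (hO.isClosed_compl.preimage hw)).csInf_mem hexit hbdd
  have hbefore : MapsTo w (Ico 0 (sInf A)) O := fun s hs =>
    not_not.1 fun h => (csInf_le hbdd ⟨hs.1, h⟩).not_gt hs.2
  have hne : 0 ≠ sInf A := fun h => hmem.2 (h ▸ hw₀)
  refine ⟨sInf A, hmem.1, hmem.2, ?_⟩
  rw [← closure_Ico hne]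
  exact hbefore.closure hw

section Fold

open scoped RealInnerProductSpace

variable {E : Type*} [NormedAddCommGroup E] [InnerProductSpace ℝ E] {V W : E → E} {ξ ℓ h : E}
  {μ ε r κ δ : ℝ} {w w₁ w₂ : ℝ → E}

/-- The quadratic form whose sublevel set `{coneForm ε ℓ ≤ 0}` is the double cone of aperture `ε`
around the line spanned by the unit vector `ℓ`. -/
def coneForm (ε : ℝ) (ℓ h : E) : ℝ := ‖h‖ ^ 2 - (1 + ε ^ 2) * ⟪ℓ, h⟫ ^ 2

lemma continuous_coneForm (ε : ℝ) (ℓ : E) : Continuous (coneForm ε ℓ) := by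
  unfold coneForm; fun_prop

lemma coneForm_le_norm_sq : coneForm ε ℓ h ≤ ‖h‖ ^ 2 :=
  sub_le_self _ (by positivity)

lemma norm_sq_le_of_coneForm_nonpos (hε : 0 ≤ ε) (hε₁ : ε ≤ 1) (hh : coneForm ε ℓ h ≤ 0) :
    ‖h‖ ^ 2 ≤ 2 * ⟪ℓ, h⟫ ^ 2 :=
  calc ‖h‖ ^ 2 ≤ (1 + ε ^ 2) * ⟪ℓ, h⟫ ^ 2 := sub_nonpos.1 hh
    _ ≤ 2 * ⟪ℓ, h⟫ ^ 2 := by gcongr; nlinarith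

lemma eq_zero_of_coneForm_nonpos (hh : coneForm ε ℓ h ≤ 0) (hz : ⟪ℓ, h⟫ = 0) : h = 0 := by
  rw [coneForm, hz, zero_pow two_ne_zero, mul_zero, sub_zero] at hh
  exact norm_eq_zero.1 (pow_eq_zero_iff two_ne_zero |>.1 (hh.antisymm (sq_nonneg _)))

lemma hasDerivAt_coneForm {h : ℝ → E} {h' : E} {s : ℝ} (hh : HasDerivAt h h' s) :
    HasDerivAt (fun s => coneForm ε ℓ (h s))
      (2 * ⟪h s, h'⟫ - 2 * (1 + ε ^ 2) * (⟪ℓ, h s⟫ * ⟪ℓ, h'⟫)) s := by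
  have hinner : HasDerivAt (fun s => ⟪ℓ, h s⟫) ⟪ℓ, h'⟫ s := by
    simpa using (hasDerivAt_const s ℓ).inner ℝ hh
  refine (hh.norm_sq.sub ((hinner.pow 2).const_mul (1 + ε ^ 2))).congr_deriv ?_
  push_cast
  ring

/-- Local estimates for a vector field `V` near a degenerate zero `ξ` whose linearization vanishes
along the unit vector `ℓ`: differences of nearby trajectories are attracted by the cone around `ℓ`,
on the cone with vertex `ξ` the component of `V` along `ℓ` is at least quadratic, and off this cone
`V` is at least linear. -/
structure IsFold (V : E → E) (ξ ℓ : E) (μ ε r κ : ℝ) : Prop where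
  zero : V ξ = 0
  unit : ‖ℓ‖ = 1
  mu_pos : 0 < μ
  eps_pos : 0 < ε
  eps_le : ε ≤ 1
  r_pos : 0 < r
  kappa_pos : 0 < κ
  cone : ∀ x ∈ Metric.ball ξ r, ∀ y ∈ Metric.ball ξ r,
    2 * ⟪x - y, V x - V y⟫ - 2 * (1 + ε ^ 2) * (⟪ℓ, x - y⟫ * ⟪ℓ, V x - V y⟫) ≤
      -μ * coneForm ε ℓ (x - y)
  drift : ∀ x ∈ Metric.ball ξ r, coneForm ε ℓ (x - ξ) ≤ 0 → κ * ⟪ℓ, x - ξ⟫ ^ 2 ≤ ⟪ℓ, V x⟫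
  transverse : ∀ x ∈ Metric.ball ξ r, 0 ≤ coneForm ε ℓ (x - ξ) →
    μ * ε / 4 * ‖x - ξ‖ ≤ ‖V x‖

lemma IsFold.congr (hV : IsFold V ξ ℓ μ ε r κ) (hW : EqOn V W (Metric.ball ξ r)) :
    IsFold W ξ ℓ μ ε r κ where
  zero := hW (Metric.mem_ball_self hV.r_pos) ▸ hV.zero
  unit := hV.unit
  mu_pos := hV.mu_pos
  eps_pos := hV.eps_pos
  eps_le := hV.eps_le
  r_pos := hV.r_pos
  kappa_pos := hV.kappa_pos
  cone x hx y hy := hW hx ▸ hW hy ▸ hV.cone x hx y hy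
  drift x hx hc := hW hx ▸ hV.drift x hx hc
  transverse x hx hc := hW hx ▸ hV.transverse x hx hc

lemma antitoneOn_exp_mul {Q Q' : ℝ → ℝ} {D : Set ℝ} (hD : Convex ℝ D)
    (hQ : ∀ s ∈ D, HasDerivAt Q (Q' s) s) (hle : ∀ s ∈ D, Q' s ≤ -μ * Q s) :
    AntitoneOn (fun s => Real.exp (μ * s) * Q s) D := by
  have hderiv : ∀ s ∈ D, HasDerivAt (fun s => Real.exp (μ * s) * Q s)
      (Real.exp (μ * s) * (μ * Q s + Q' s)) s := fun s hs => by
    have hexp : HasDerivAt (fun s => Real.exp (μ * s)) (Real.exp (μ * s) * μ) s := by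
      simpa using ((hasDerivAt_id s).const_mul μ).exp
    exact (hexp.mul (hQ s hs)).congr_deriv (by ring)
  refine antitoneOn_of_hasDerivWithinAt_nonpos hD (HasDerivAt.continuousOn hderiv)
    (fun s hs => (hderiv s (interior_subset hs)).hasDerivWithinAt) fun s hs => ?_
  exact mul_nonpos_of_nonneg_of_nonpos (Real.exp_pos _).le
    (by linarith [hle s (interior_subset hs)])

lemma hasDerivAt_coordinate (hw : IsIntegralCurve w fun _ => V) (ξ ℓ : E) (s : ℝ) :
    HasDerivAt (fun s => ⟪ℓ, w s - ξ⟫) ⟪ℓ, V (w s)⟫ s := by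
  simpa using (hasDerivAt_const s ℓ).inner ℝ ((hw s).sub_const ξ)

lemma tendsto_coordinate {l : Filter ℝ} (hw : Tendsto w l (𝓝 ξ)) (ℓ : E) :
    Tendsto (fun s => ⟪ℓ, w s - ξ⟫) l (𝓝 0) := by
  simpa using tendsto_const_nhds.inner (hw.sub_const ξ)

namespace IsFold

lemma antitoneOn_exp_mul_coneForm (hV : IsFold V ξ ℓ μ ε r κ) (h₁ : IsIntegralCurve w₁ fun _ => V)
    (h₂ : IsIntegralCurve w₂ fun _ => V) {D : Set ℝ} (hD : Convex ℝ D)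
    (hw₁ : MapsTo w₁ D (Metric.ball ξ r)) (hw₂ : MapsTo w₂ D (Metric.ball ξ r)) :
    AntitoneOn (fun s => Real.exp (μ * s) * coneForm ε ℓ (w₁ s - w₂ s)) D :=
  antitoneOn_exp_mul hD (fun s _ => hasDerivAt_coneForm ((h₁ s).sub (h₂ s)))
    fun _ hs => hV.cone _ (hw₁ hs) _ (hw₂ hs)

/-- Otherwise the cone form of the difference would blow up exponentially in the past. -/
theorem coneForm_sub_nonpos (hV : IsFold V ξ ℓ μ ε r κ) (h₁ : IsIntegralCurve w₁ fun _ => V)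
    (h₂ : IsIntegralCurve w₂ fun _ => V) {S : ℝ} (hw₁ : MapsTo w₁ (Iic S) (Metric.ball ξ r))
    (hw₂ : MapsTo w₂ (Iic S) (Metric.ball ξ r)) {s : ℝ} (hs : s ≤ S) :
    coneForm ε ℓ (w₁ s - w₂ s) ≤ 0 := by
  have hanti := hV.antitoneOn_exp_mul_coneForm h₁ h₂ (convex_Iic S) hw₁ hw₂
  have hlim : Tendsto (fun t => Real.exp (μ * t) * (2 * r) ^ 2) atBot (𝓝 0) := by
    simpa using (Real.tendsto_exp_atBot.comp
      (tendsto_id.const_mul_atBot hV.mu_pos)).mul_const ((2 * r) ^ 2)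
  have hbound : ∀ t ≤ S, coneForm ε ℓ (w₁ t - w₂ t) ≤ (2 * r) ^ 2 := fun t ht => by
    refine coneForm_le_norm_sq.trans (pow_le_pow_left₀ (norm_nonneg _) ?_ 2)
    rw [← dist_eq_norm]
    linarith [dist_triangle_right (w₁ t) (w₂ t) ξ, Metric.mem_ball.1 (hw₁ ht),
      Metric.mem_ball.1 (hw₂ ht)]
  have hle : Real.exp (μ * s) * coneForm ε ℓ (w₁ s - w₂ s) ≤ 0 :=
    ge_of_tendsto hlim <| (eventually_le_atBot s).mono fun t hts =>
      (hanti (hts.trans hs) hs hts).trans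
        (mul_le_mul_of_nonneg_left (hbound t (hts.trans hs)) (Real.exp_pos _).le)
  exact nonpos_of_mul_nonpos_right hle (Real.exp_pos _)

lemma coneForm_sub_vertex_nonpos (hV : IsFold V ξ ℓ μ ε r κ) (hw : IsIntegralCurve w fun _ => V)
    {S : ℝ} (hball : MapsTo w (Iic S) (Metric.ball ξ r)) {s : ℝ} (hs : s ≤ S) :
    coneForm ε ℓ (w s - ξ) ≤ 0 :=
  hV.coneForm_sub_nonpos hw (isIntegralCurve_const fun _ => hV.zero) hball
    (fun _ _ => Metric.mem_ball_self hV.r_pos) hs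

lemma monotoneOn_coordinate (hV : IsFold V ξ ℓ μ ε r κ) (hw : IsIntegralCurve w fun _ => V)
    {D : Set ℝ} (hD : Convex ℝ D) (hball : MapsTo w D (Metric.ball ξ r))
    (hcone : ∀ s ∈ D, coneForm ε ℓ (w s - ξ) ≤ 0) : MonotoneOn (fun s => ⟪ℓ, w s - ξ⟫) D :=
  monotoneOn_of_hasDerivWithinAt_nonneg hD
    (HasDerivAt.continuousOn fun s _ => hasDerivAt_coordinate hw ξ ℓ s)
    (fun s _ => (hasDerivAt_coordinate hw ξ ℓ s).hasDerivWithinAt) fun s hs =>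
      (mul_nonneg hV.kappa_pos.le (sq_nonneg _)).trans
        (hV.drift _ (hball (interior_subset hs)) (hcone s (interior_subset hs)))

lemma exists_mapsTo_Iic_coordinate_pos [CompleteSpace E] (hV : IsFold V ξ ℓ μ ε r κ)
    (hV₁ : ContDiff ℝ 1 V) (hw : IsIntegralCurve w fun _ => V) (hne : ∃ s, w s ≠ ξ)
    (hlim : Tendsto w atBot (𝓝 ξ)) :
    ∃ S, MapsTo w (Iic S) (Metric.ball ξ r) ∧ ∀ s ≤ S, 0 < ⟪ℓ, w s - ξ⟫ := by
  obtain ⟨S, hS⟩ := eventually_atBot.1 (hlim.eventually (Metric.ball_mem_nhds ξ hV.r_pos))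
  refine ⟨S, hS, fun s hs => lt_of_le_of_ne ?_ fun h => ?_⟩
  · have hmono := hV.monotoneOn_coordinate hw (convex_Iic S) hS
      fun s hs => hV.coneForm_sub_vertex_nonpos hw hS hs
    exact le_of_tendsto (tendsto_coordinate hlim ℓ)
      ((eventually_le_atBot s).mono fun t ht => hmono (ht.trans hs) hs ht)
  · have hws : w s = ξ := sub_eq_zero.1
      (eq_zero_of_coneForm_nonpos (hV.coneForm_sub_vertex_nonpos hw hS hs) h.symm)
    obtain ⟨t, ht⟩ := hne
    exact ht (congrFun (eq_of_isIntegralCurve hV₁ hw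
      (isIntegralCurve_const fun _ => hV.zero) hws) t)

end IsFold

lemma exists_coordinate_eq {S a : ℝ} (hw : Continuous w) (hlim : Tendsto w atBot (𝓝 ξ))
    (ha : 0 < a) (haS : a ≤ ⟪ℓ, w S - ξ⟫) : ∃ s ≤ S, ⟪ℓ, w s - ξ⟫ = a := by
  obtain ⟨t, hta, htS⟩ := (((tendsto_coordinate hlim ℓ).eventually_lt_const ha).and
    (eventually_le_atBot S)).exists
  have hcont : Continuous fun s => ⟪ℓ, w s - ξ⟫ := by fun_prop
  obtain ⟨s, hs, hsa⟩ := intermediate_value_Icc htS hcont.continuousOn ⟨hta.le, haS⟩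
  exact ⟨s, hs.2, hsa⟩

/-- Translate so that both trajectories have the same coordinate along `ℓ` at one time; their
difference lies in the cone, hence vanishes there. -/
theorem IsFold.eq_comp_add_of_tendsto [CompleteSpace E] (hV : IsFold V ξ ℓ μ ε r κ)
    (hV₁ : ContDiff ℝ 1 V)
    (h₁ : IsIntegralCurve w₁ fun _ => V) (hne₁ : ∃ s, w₁ s ≠ ξ) (hlim₁ : Tendsto w₁ atBot (𝓝 ξ))
    (h₂ : IsIntegralCurve w₂ fun _ => V) (hne₂ : ∃ s, w₂ s ≠ ξ) (hlim₂ : Tendsto w₂ atBot (𝓝 ξ)) :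
    ∃ c, ∀ s, w₁ s = w₂ (s + c) := by
  obtain ⟨S₁, hball₁, hpos₁⟩ := hV.exists_mapsTo_Iic_coordinate_pos hV₁ h₁ hne₁ hlim₁
  obtain ⟨S₂, hball₂, hpos₂⟩ := hV.exists_mapsTo_Iic_coordinate_pos hV₁ h₂ hne₂ hlim₂
  obtain ⟨s₁, hs₁, s₂, hs₂, heq⟩ : ∃ s₁ ≤ S₁, ∃ s₂ ≤ S₂, ⟪ℓ, w₁ s₁ - ξ⟫ = ⟪ℓ, w₂ s₂ - ξ⟫ := by
    rcases le_total ⟪ℓ, w₁ S₁ - ξ⟫ ⟪ℓ, w₂ S₂ - ξ⟫ with h | h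
    · obtain ⟨s, hs, hsa⟩ := exists_coordinate_eq h₂.continuous hlim₂ (hpos₁ S₁ le_rfl) h
      exact ⟨S₁, le_rfl, s, hs, hsa.symm⟩
    · obtain ⟨s, hs, hsa⟩ := exists_coordinate_eq h₁.continuous hlim₁ (hpos₂ S₂ le_rfl) h
      exact ⟨s, hs, S₂, le_rfl, hsa⟩
  have hshift : IsIntegralCurve (fun s => w₂ (s + (s₂ - s₁))) fun _ => V := h₂.comp_add _
  have hcone : coneForm ε ℓ (w₁ s₁ - w₂ (s₁ + (s₂ - s₁))) ≤ 0 :=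
    hV.coneForm_sub_nonpos h₁ hshift (S := s₁) (fun s hs => hball₁ (le_trans hs hs₁))
      (fun s hs => hball₂ (by rw [mem_Iic] at hs ⊢; linarith)) le_rfl
  have hmeet : w₁ s₁ = w₂ (s₁ + (s₂ - s₁)) := by
    refine sub_eq_zero.1 (eq_zero_of_coneForm_nonpos hcone ?_)
    rw [add_sub_cancel, ← sub_sub_sub_cancel_right _ _ ξ, inner_sub_right, heq, sub_self]
  exact ⟨s₂ - s₁, congrFun (eq_of_isIntegralCurve hV₁ h₁ hshift hmeet)⟩

/-- The part of the cone of aperture `ε` with vertex `ξ` and axis `ℓ` on which the coordinate along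
`ℓ` lies in `[0, δ]`. -/
def truncatedCone (ξ ℓ : E) (ε δ : ℝ) : Set E :=
  {x | coneForm ε ℓ (x - ξ) ≤ 0 ∧ ⟪ℓ, x - ξ⟫ ∈ Icc 0 δ}

/-- The version of `truncatedCone` with strict inequalities, from which trajectories exit. -/
def openTruncatedCone (ξ ℓ : E) (ε δ : ℝ) : Set E :=
  {x | coneForm ε ℓ (x - ξ) < 0 ∧ ⟪ℓ, x - ξ⟫ ∈ Ioo 0 δ}

lemma isClosed_truncatedCone (ξ ℓ : E) (ε δ : ℝ) : IsClosed (truncatedCone ξ ℓ ε δ) :=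
  (isClosed_le ((continuous_coneForm ε ℓ).comp (by fun_prop)) continuous_const).inter
    (isClosed_Icc.preimage (by fun_prop))

lemma isOpen_openTruncatedCone (ξ ℓ : E) (ε δ : ℝ) : IsOpen (openTruncatedCone ξ ℓ ε δ) :=
  (isOpen_lt ((continuous_coneForm ε ℓ).comp (by fun_prop)) continuous_const).inter
    (isOpen_Ioo.preimage (by fun_prop))

lemma closure_openTruncatedCone_subset : closure (openTruncatedCone ξ ℓ ε δ) ⊆
    truncatedCone ξ ℓ ε δ :=
  closure_minimal (fun _ hx => ⟨hx.1.le, Ioo_subset_Icc_self hx.2⟩) (isClosed_truncatedCone ξ ℓ ε δ)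

lemma add_smul_mem_openTruncatedCone (hℓ : ‖ℓ‖ = 1) (hε : 0 < ε) {a : ℝ} (ha : a ∈ Ioo 0 δ) :
    ξ + a • ℓ ∈ openTruncatedCone ξ ℓ ε δ := by
  have hcoord : ⟪ℓ, ξ + a • ℓ - ξ⟫ = a := by
    rw [add_sub_cancel_left, inner_smul_right, real_inner_self_eq_norm_sq, hℓ, one_pow, mul_one]
  refine ⟨?_, hcoord.symm ▸ ha⟩
  rw [coneForm, hcoord, add_sub_cancel_left, norm_smul, hℓ, mul_one, Real.norm_eq_abs, sq_abs]
  have : 0 < ε ^ 2 * a ^ 2 := mul_pos (pow_pos hε 2) (pow_pos ha.1 2)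
  linarith

namespace IsFold

lemma truncatedCone_subset_closedBall (hV : IsFold V ξ ℓ μ ε r κ) :
    truncatedCone ξ ℓ ε δ ⊆ Metric.closedBall ξ (2 * δ) := by
  intro x hx
  have hsq : ‖x - ξ‖ ^ 2 ≤ (2 * δ) ^ 2 :=
    calc ‖x - ξ‖ ^ 2 ≤ 2 * ⟪ℓ, x - ξ⟫ ^ 2 :=
          norm_sq_le_of_coneForm_nonpos hV.eps_pos.le hV.eps_le hx.1
      _ ≤ 2 * δ ^ 2 := by gcongr; exacts [hx.2.1, hx.2.2]
      _ ≤ (2 * δ) ^ 2 := by nlinarith [sq_nonneg δ]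
  have hδ : 0 ≤ δ := hx.2.1.trans hx.2.2
  exact mem_closedBall_iff_norm.2 (le_of_sq_le_sq hsq (by positivity))

lemma truncatedCone_subset_ball (hV : IsFold V ξ ℓ μ ε r κ) :
    truncatedCone ξ ℓ ε (r / 4) ⊆ Metric.ball ξ r :=
  hV.truncatedCone_subset_closedBall.trans
    (Metric.closedBall_subset_ball (by linarith [hV.r_pos]))

lemma isCompact_truncatedCone [ProperSpace E] (hV : IsFold V ξ ℓ μ ε r κ) :
    IsCompact (truncatedCone ξ ℓ ε δ) :=
  (isCompact_closedBall ξ (2 * δ)).of_isClosed_subset (isClosed_truncatedCone ξ ℓ ε δ)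
    hV.truncatedCone_subset_closedBall

lemma monotoneOn_coordinate_of_mapsTo_truncatedCone (hV : IsFold V ξ ℓ μ ε r κ)
    (hw : IsIntegralCurve w fun _ => V) {D : Set ℝ} (hD : Convex ℝ D)
    (hcone : MapsTo w D (truncatedCone ξ ℓ ε (r / 4))) : MonotoneOn (fun s => ⟪ℓ, w s - ξ⟫) D :=
  hV.monotoneOn_coordinate hw hD (hcone.mono_right hV.truncatedCone_subset_ball)
    fun _ hs => (hcone hs).1

/-- The drift bounds the time a trajectory can spend in the truncated cone. -/
lemma sq_coordinate_mul_sub_le (hV : IsFold V ξ ℓ μ ε r κ) (hw : IsIntegralCurve w fun _ => V)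
    {s t : ℝ} (hst : s ≤ t) (hcone : MapsTo w (Icc s t) (truncatedCone ξ ℓ ε (r / 4))) :
    κ * ⟪ℓ, w s - ξ⟫ ^ 2 * (t - s) ≤ r / 4 := by
  have hmono := hV.monotoneOn_coordinate_of_mapsTo_truncatedCone hw (convex_Icc s t) hcone
  have hs := left_mem_Icc.2 hst
  have ht := right_mem_Icc.2 hst
  have hspeed : ∀ x ∈ Icc s t, κ * ⟪ℓ, w s - ξ⟫ ^ 2 ≤ ⟪ℓ, V (w x)⟫ := fun x hx =>
    (mul_le_mul_of_nonneg_left (pow_le_pow_left₀ (hcone hs).2.1 (hmono hs hx hx.1) 2)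
      hV.kappa_pos.le).trans (hV.drift _ (hV.truncatedCone_subset_ball (hcone hx)) (hcone hx).1)
  have hgrowth := (convex_Icc s t).mul_sub_le_image_sub_of_le_deriv
    (HasDerivAt.continuousOn fun x _ => hasDerivAt_coordinate hw ξ ℓ x)
    (fun x _ => (hasDerivAt_coordinate hw ξ ℓ x).differentiableAt.differentiableWithinAt)
    (fun x hx => (hasDerivAt_coordinate hw ξ ℓ x).deriv ▸ hspeed x (interior_subset hx))
    s hs t ht hst
  linarith [(hcone hs).2.1, (hcone ht).2.2]

lemma exists_notMem_openTruncatedCone (hV : IsFold V ξ ℓ μ ε r κ)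
    (hw : IsIntegralCurve w fun _ => V) (hw₀ : 0 < ⟪ℓ, w 0 - ξ⟫) :
    ∃ s, 0 ≤ s ∧ w s ∉ openTruncatedCone ξ ℓ ε (r / 4) := by
  by_contra! hstay
  have hspeed : 0 < κ * ⟪ℓ, w 0 - ξ⟫ ^ 2 := mul_pos hV.kappa_pos (pow_pos hw₀ 2)
  obtain ⟨N, hN⟩ := exists_nat_gt (r / 4 / (κ * ⟪ℓ, w 0 - ξ⟫ ^ 2))
  have htime := hV.sq_coordinate_mul_sub_le hw N.cast_nonneg fun s hs =>
    closure_openTruncatedCone_subset (subset_closure (hstay s hs.1))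
  rw [div_lt_iff₀ hspeed] at hN
  linarith

lemma coneForm_neg_of_mapsTo_truncatedCone (hV : IsFold V ξ ℓ μ ε r κ)
    (hw : IsIntegralCurve w fun _ => V) {T : ℝ} (hT : 0 ≤ T)
    (hcone : MapsTo w (Icc 0 T) (truncatedCone ξ ℓ ε (r / 4))) (hw₀ : coneForm ε ℓ (w 0 - ξ) < 0) :
    coneForm ε ℓ (w T - ξ) < 0 := by
  have hanti := hV.antitoneOn_exp_mul_coneForm hw (isIntegralCurve_const fun _ => hV.zero)
    (convex_Icc 0 T) (hcone.mono_right hV.truncatedCone_subset_ball)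
    (fun _ _ => Metric.mem_ball_self hV.r_pos) (left_mem_Icc.2 hT) (right_mem_Icc.2 hT) hT
  simp only [mul_zero, Real.exp_zero, one_mul] at hanti
  exact neg_of_mul_neg_right (hanti.trans_lt hw₀) (Real.exp_pos _).le

theorem exists_exit (hV : IsFold V ξ ℓ μ ε r κ) (hw : IsIntegralCurve w fun _ => V)
    (hw₀ : w 0 ∈ openTruncatedCone ξ ℓ ε (r / 4)) :
    ∃ T, 0 ≤ T ∧ ⟪ℓ, w T - ξ⟫ = r / 4 ∧ MapsTo w (Icc 0 T) (truncatedCone ξ ℓ ε (r / 4)) := by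
  obtain ⟨T, hT, hout, hclosure⟩ := exists_first_exit (isOpen_openTruncatedCone ξ ℓ ε (r / 4))
    hw.continuous hw₀ (hV.exists_notMem_openTruncatedCone hw hw₀.2.1)
  have hcone : MapsTo w (Icc 0 T) (truncatedCone ξ ℓ ε (r / 4)) := fun s hs =>
    closure_openTruncatedCone_subset (hclosure s hs)
  have hpos : 0 < ⟪ℓ, w T - ξ⟫ := hw₀.2.1.trans_le <|
    hV.monotoneOn_coordinate_of_mapsTo_truncatedCone hw (convex_Icc 0 T) hcone (left_mem_Icc.2 hT)
      (right_mem_Icc.2 hT) hT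
  refine ⟨T, hT, (hcone (right_mem_Icc.2 hT)).2.2.eq_of_not_lt fun hlt => hout ?_, hcone⟩
  exact ⟨hV.coneForm_neg_of_mapsTo_truncatedCone hw hT hcone hw₀.1, hpos, hlt⟩

/-- A trajectory starting very close to the vertex on the axis of the cone needs a long time to
exit. -/
lemma exists_isIntegralCurve_mapsTo_truncatedCone [CompleteSpace E] (hV : IsFold V ξ ℓ μ ε r κ)
    (hV₁ : ContDiff ℝ 1 V) {K : NNReal} (hK : LipschitzWith K V) {τ : ℝ} (hτ : 0 ≤ τ) :
    ∃ w, (IsIntegralCurve w fun _ => V) ∧ ⟪ℓ, w 0 - ξ⟫ = r / 4 ∧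
      MapsTo w (Icc (-τ) 0) (truncatedCone ξ ℓ ε (r / 4)) := by
  have hr := hV.r_pos
  set a := r / 8 * Real.exp (-(K * τ)) with ha_def
  have ha : a ∈ Ioo 0 (r / 4) := by
    refine ⟨by positivity, ha_def ▸ ?_⟩
    have : Real.exp (-(K * τ)) ≤ 1 := Real.exp_le_one_iff.2 (neg_nonpos.2 (by positivity))
    nlinarith
  obtain ⟨w, hw₀, hw⟩ := exists_isIntegralCurve_of_lipschitzWith hV₁ hK (ξ + a • ℓ)
  obtain ⟨T, hT, hwT, hcone⟩ := hV.exists_exit hw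
    (hw₀ ▸ add_smul_mem_openTruncatedCone hV.unit hV.eps_pos ha)
  have hτT : τ ≤ T := by
    by_contra! hlt
    have hnear := dist_le_of_isIntegralCurve hK hw (isIntegralCurve_const fun _ => hV.zero) T
    rw [hw₀, dist_self_add_left, norm_smul, hV.unit, mul_one, Real.norm_eq_abs, abs_of_pos ha.1,
      abs_of_nonneg hT, mul_assoc, ← Real.exp_add] at hnear
    have hfar : r / 4 ≤ dist (w T) ξ := by
      rw [← hwT, dist_eq_norm]
      simpa [hV.unit] using real_inner_le_norm ℓ (w T - ξ)
    have hexp : Real.exp (-(K * τ) + K * T) ≤ 1 := Real.exp_le_one_iff.2 <| by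
      linarith [mul_le_mul_of_nonneg_left hlt.le K.coe_nonneg]
    nlinarith
  refine ⟨fun s => w (s + T), hw.comp_add T, by simpa only [zero_add] using hwT,
    fun s hs => hcone ?_⟩
  exact ⟨by linarith [hs.1], by linarith [hs.2]⟩

lemma tendsto_atBot_of_mapsTo_truncatedCone (hV : IsFold V ξ ℓ μ ε r κ)
    (hw : IsIntegralCurve w fun _ => V)
    (hcone : MapsTo w (Iic 0) (truncatedCone ξ ℓ ε (r / 4))) : Tendsto w atBot (𝓝 ξ) := by
  have hbound : ∀ s < 0, ‖w s - ξ‖ ^ 2 ≤ r / (2 * κ) / -s := fun s hs => by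
    have htime := hV.sq_coordinate_mul_sub_le hw hs.le (hcone.mono_left Icc_subset_Iic_self)
    have hnorm := norm_sq_le_of_coneForm_nonpos hV.eps_pos.le hV.eps_le (hcone hs.le).1
    have hκ := hV.kappa_pos
    rw [le_div_iff₀ (neg_pos.2 hs), le_div_iff₀ (by positivity)]
    nlinarith [mul_le_mul_of_nonneg_right hnorm (mul_pos (neg_pos.2 hs) hκ).le]
  have hlim : Tendsto (fun s : ℝ => r / (2 * κ) / -s) atBot (𝓝 0) :=
    tendsto_neg_atBot_atTop.const_div_atTop _
  have hsq : Tendsto (fun s => ‖w s - ξ‖ ^ 2) atBot (𝓝 0) :=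
    squeeze_zero' (.of_forall fun s => sq_nonneg _) ((eventually_lt_atBot 0).mono hbound) hlim
  rw [tendsto_iff_norm_sub_tendsto_zero]
  simpa only [Real.sqrt_sq (norm_nonneg _), Real.sqrt_zero] using hsq.sqrt

theorem exists_isIntegralCurve_tendsto [ProperSpace E] (hV : IsFold V ξ ℓ μ ε r κ)
    (hV₁ : ContDiff ℝ 1 V) {K : NNReal} (hK : LipschitzWith K V) :
    ∃ w, (IsIntegralCurve w fun _ => V) ∧ w 0 ≠ ξ ∧ MapsTo w (Iic 0) (Metric.ball ξ r) ∧
      Tendsto w atBot (𝓝 ξ) := by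
  choose v hv hv₀ hvcone using fun N : ℕ =>
    hV.exists_isIntegralCurve_mapsTo_truncatedCone hV₁ hK N.cast_nonneg
  obtain ⟨w, φ, hw, hφ, hlim⟩ := exists_subseq_tendsto_isIntegralCurve hV₁ hK
    hV.isCompact_truncatedCone hv fun N => hvcone N ⟨neg_nonpos.2 N.cast_nonneg, le_rfl⟩
  have hcone : MapsTo w (Iic 0) (truncatedCone ξ ℓ ε (r / 4)) := fun s hs => by
    refine (isClosed_truncatedCone ξ ℓ ε (r / 4)).mem_of_tendsto (hlim s) ?_
    have hlarge : ∀ᶠ N in atTop, -s ≤ (φ N : ℝ) :=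
      (tendsto_natCast_atTop_atTop.comp hφ.tendsto_atTop).eventually_ge_atTop (-s)
    exact hlarge.mono fun N hN => hvcone (φ N) ⟨by linarith, hs⟩
  refine ⟨w, hw, ?_, hcone.mono_right hV.truncatedCone_subset_ball,
    hV.tendsto_atBot_of_mapsTo_truncatedCone hw hcone⟩
  have hw₀ : ⟪ℓ, w 0 - ξ⟫ = r / 4 :=
    tendsto_nhds_unique (tendsto_const_nhds.inner ((hlim 0).sub_const ξ)) (by simp [hv₀])
  intro h
  rw [h, sub_self, inner_zero_right] at hw₀
  linarith [hV.r_pos]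

end IsFold

end Fold

section FoldEstimates

open scoped RealInnerProductSpace

variable {E : Type*} [NormedAddCommGroup E]

lemma hasFDerivAt_taylor_remainder [NormedSpace ℝ E] {F : E → E} {A : E →L[ℝ] E}
    {D : E →L[ℝ] E →L[ℝ] E} (hD : ∀ a b, D a b = D b a) (ξ : E) {y : E}
    (hF : DifferentiableAt ℝ F y) :
    HasFDerivAt (fun y => F y - A (y - ξ) - (1 / 2 : ℝ) • D (y - ξ) (y - ξ))
      (fderiv ℝ F y - A - D (y - ξ)) y := by
  have hsub : HasFDerivAt (fun y : E => y - ξ) (ContinuousLinearMap.id ℝ E) y :=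
    (hasFDerivAt_id y).sub_const ξ
  have hquad := ((D.hasFDerivAt.comp y hsub).clm_apply hsub).const_smul (1 / 2 : ℝ)
  refine ((hF.hasFDerivAt.sub (A.hasFDerivAt.comp y hsub)).sub hquad).congr_fderiv ?_
  ext v
  have hhalf : (1 / 2 : ℝ) • (D (y - ξ) v + D v (y - ξ)) = D (y - ξ) v := by
    rw [hD v, ← two_smul ℝ, smul_smul]
    norm_num
  simpa using hhalf

theorem eventually_taylor_two_le [NormedSpace ℝ E] {F : E → E} (hF : ContDiff ℝ 2 F) (ξ : E) {κ : ℝ}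
    (hκ : 0 < κ) :
    ∀ᶠ x in 𝓝 ξ, ‖F x - F ξ - fderiv ℝ F ξ (x - ξ) -
      (1 / 2 : ℝ) • fderiv ℝ (fderiv ℝ F) ξ (x - ξ) (x - ξ)‖ ≤ κ * ‖x - ξ‖ ^ 2 := by
  set A := fderiv ℝ F ξ
  set D := fderiv ℝ (fderiv ℝ F) ξ
  have hsymm : ∀ a b, D a b = D b a :=
    (hF.contDiffAt (x := ξ)).isSymmSndFDerivAt (by simp)
  have hDF : HasFDerivAt (fderiv ℝ F) D ξ :=
    ((hF.fderiv_right (m := 1) (by norm_num)).differentiable one_ne_zero ξ).hasFDerivAt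
  obtain ⟨r, hr, hsmall⟩ := Metric.eventually_nhds_iff_ball.1
    ((hasFDerivAt_iff_isLittleO.1 hDF).def hκ)
  filter_upwards [Metric.ball_mem_nhds ξ hr] with x hx
  have hbound : ∀ y ∈ Metric.closedBall ξ ‖x - ξ‖,
      ‖fderiv ℝ F y - A - D (y - ξ)‖ ≤ κ * ‖x - ξ‖ := fun y hy => by
    rw [mem_closedBall_iff_norm] at hy
    have hyr : y ∈ Metric.ball ξ r := mem_ball_iff_norm.2 (hy.trans_lt (mem_ball_iff_norm.1 hx))
    exact (hsmall y hyr).trans (by gcongr)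
  have hmean := (convex_closedBall ξ ‖x - ξ‖).norm_image_sub_le_of_norm_hasFDerivWithin_le
    (fun y _ => (hasFDerivAt_taylor_remainder (A := A) hsymm ξ
      (hF.differentiable two_ne_zero y)).hasFDerivWithinAt) hbound
    (Metric.mem_closedBall_self (norm_nonneg _)) (show x ∈ _ by simp [dist_eq_norm])
  calc _ = _ := by
        simp only [sub_self, map_zero, smul_zero, sub_zero]
        congr 1
        abel
    _ ≤ κ * ‖x - ξ‖ * ‖x - ξ‖ := hmean
    _ = _ := by ring

variable [InnerProductSpace ℝ E]

theorem exists_coercive_of_pos [ProperSpace E] {A : E →L[ℝ] E} {C : Set E} (hC : IsClosed C)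
    (hsmul : ∀ y ∈ C, ∀ c : ℝ, c • y ∈ C) (hpos : ∀ y ∈ C, y ≠ 0 → 0 < ⟪A y, y⟫) :
    ∃ μ > 0, ∀ y ∈ C, μ * ‖y‖ ^ 2 ≤ ⟪A y, y⟫ := by
  set S : Set E := Metric.sphere 0 1 ∩ C
  have hScpt : IsCompact S := (isCompact_sphere 0 1).inter_right hC
  obtain ⟨μ, hμ, hμS⟩ : ∃ μ > 0, ∀ y ∈ S, μ ≤ ⟪A y, y⟫ := by
    rcases S.eq_empty_or_nonempty with hempty | hne
    · exact ⟨1, one_pos, by simp [hempty]⟩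
    · obtain ⟨y, hy, hmin⟩ := hScpt.exists_isMinOn hne
        (f := fun y => ⟪A y, y⟫) (by fun_prop)
      exact ⟨_, hpos y hy.2 (ne_zero_of_mem_unit_sphere ⟨y, hy.1⟩), fun x hx => hmin hx⟩
  refine ⟨μ, hμ, fun y hy => ?_⟩
  rcases eq_or_ne y 0 with rfl | hy0
  · simp
  have hn : 0 < ‖y‖ := norm_pos_iff.2 hy0
  have hunit := hμS (‖y‖⁻¹ • y) ⟨by simp [norm_smul, hn.ne'], hsmul y hy _⟩
  rw [map_smul, real_inner_smul_left, real_inner_smul_right] at hunit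
  calc μ * ‖y‖ ^ 2 ≤ (‖y‖⁻¹ * (‖y‖⁻¹ * ⟪A y, y⟫)) * ‖y‖ ^ 2 := by gcongr
    _ = ⟪A y, y⟫ := by field_simp

variable {A : E →L[ℝ] E} {ℓ h v : E} {μ ε κ : ℝ}

lemma apply_eq_zero_of_inner_apply_self_eq_zero (hA : A.IsPositive) (hh : ⟪A h, h⟫ = 0) :
    A h = 0 := by
  have hquad : ∀ t : ℝ, 0 ≤ ⟪A (A h), A h⟫ * (t * t) + (2 * ‖A h‖ ^ 2) * t + 0 := fun t => by
    have hcross : ⟪A (A h), h⟫ = ‖A h‖ ^ 2 := by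
      rw [hA.inner_left_eq_inner_right, real_inner_self_eq_norm_sq]
    have hnonneg := hA.inner_nonneg_left (h + t • A h)
    simp only [map_add, map_smul, inner_add_left, inner_add_right, real_inner_smul_left,
      real_inner_smul_right, hh, hcross, real_inner_self_eq_norm_sq] at hnonneg
    linarith
  have hdiscrim := discrim_le_zero hquad
  rw [discrim, mul_zero, sub_zero] at hdiscrim
  simpa using hdiscrim.antisymm (sq_nonneg _)

lemma inner_apply_eq_zero (hA : A.IsPositive) (hℓ : A ℓ = 0) (h : E) : ⟪ℓ, A h⟫ = 0 := by
  rw [← hA.inner_left_eq_inner_right, hℓ, inner_zero_left]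

lemma norm_sq_eq_inner_sq_add (hℓ : ‖ℓ‖ = 1) (h : E) :
    ‖h‖ ^ 2 = ⟪ℓ, h⟫ ^ 2 + ‖h - ⟪ℓ, h⟫ • ℓ‖ ^ 2 := by
  rw [norm_sub_sq_real, norm_smul, real_inner_smul_right, real_inner_comm, hℓ,
    Real.norm_eq_abs, mul_one, sq_abs]
  ring

theorem exists_coercive_of_ker_eq_span [ProperSpace E] (hA : A.IsPositive) (hℓ : ‖ℓ‖ = 1)
    (hker : A.ker = Submodule.span ℝ {ℓ}) :
    ∃ μ > 0, ∀ h, μ * ‖h - ⟪ℓ, h⟫ • ℓ‖ ^ 2 ≤ ⟪h, A h⟫ := by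
  have hAℓ : A ℓ = 0 := LinearMap.mem_ker.1 (hker ▸ Submodule.mem_span_singleton_self ℓ)
  obtain ⟨μ, hμ, hcoer⟩ := exists_coercive_of_pos (A := A) (C := {y | ⟪ℓ, y⟫ = 0})
    (isClosed_eq (by fun_prop) continuous_const)
    (fun y (hy : ⟪ℓ, y⟫ = 0) c => show ⟪ℓ, c • y⟫ = 0 by rw [real_inner_smul_right, hy, mul_zero])
    fun y (hy : ⟪ℓ, y⟫ = 0) hy0 => (hA.inner_nonneg_left y).lt_of_ne fun h0 => hy0 <| by
      have hAy : y ∈ A.ker := apply_eq_zero_of_inner_apply_self_eq_zero hA h0.symm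
      rw [hker] at hAy
      obtain ⟨c, rfl⟩ := Submodule.mem_span_singleton.1 hAy
      rw [← inner_self_eq_zero (𝕜 := ℝ), real_inner_smul_left, hy, mul_zero]
  refine ⟨μ, hμ, fun h => (hcoer (h - ⟪ℓ, h⟫ • ℓ) ?_).trans_eq ?_⟩
  · change ⟪ℓ, h - ⟪ℓ, h⟫ • ℓ⟫ = 0
    rw [inner_sub_right, real_inner_smul_right, real_inner_self_eq_norm_sq, hℓ]
    ring
  · rw [map_sub, map_smul, hAℓ, smul_zero, sub_zero, inner_sub_right, real_inner_smul_right,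
      real_inner_comm ℓ, inner_apply_eq_zero hA hAℓ, mul_zero, sub_zero, real_inner_comm]

lemma cone_le_of_coercive (hA : A.IsPositive) (hAℓ : A ℓ = 0) (hℓ : ‖ℓ‖ = 1)
    (hcoer : μ * ‖h - ⟪ℓ, h⟫ • ℓ‖ ^ 2 ≤ ⟪h, A h⟫) (hμ : 0 ≤ μ) (hε : 0 ≤ ε) (hε₁ : ε ≤ 1)
    (hv : ‖v - A h‖ ≤ μ * ε ^ 2 / 6 * ‖h‖) :
    2 * ⟪h, -v⟫ - 2 * (1 + ε ^ 2) * (⟪ℓ, h⟫ * ⟪ℓ, -v⟫) ≤ -μ * coneForm ε ℓ h := by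
  obtain ⟨e, rfl⟩ : ∃ e, v = A h + e := ⟨v - A h, by abel⟩
  rw [add_sub_cancel_left] at hv
  have hε₂ : ε ^ 2 ≤ 1 := pow_le_one₀ hε hε₁
  have hpyth := norm_sq_eq_inner_sq_add hℓ h
  have hradial : -⟪h, e⟫ ≤ μ * ε ^ 2 / 6 * ‖h‖ ^ 2 :=
    calc -⟪h, e⟫ ≤ ‖h‖ * ‖e‖ := neg_le.1 (neg_le_of_abs_le (abs_real_inner_le_norm h e))
      _ ≤ ‖h‖ * (μ * ε ^ 2 / 6 * ‖h‖) := by gcongr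
      _ = _ := by ring
  have haxial : (1 + ε ^ 2) * (⟪ℓ, h⟫ * ⟪ℓ, e⟫) ≤ 2 * (μ * ε ^ 2 / 6 * ‖h‖ ^ 2) := by
    have hh : |⟪ℓ, h⟫| ≤ ‖h‖ := by simpa [hℓ] using abs_real_inner_le_norm ℓ h
    have he : |⟪ℓ, e⟫| ≤ ‖e‖ := by simpa [hℓ] using abs_real_inner_le_norm ℓ e
    calc _ ≤ (1 + ε ^ 2) * (|⟪ℓ, h⟫| * |⟪ℓ, e⟫|) := by
          rw [← abs_mul]
          gcongr
          exact le_abs_self _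
      _ ≤ 2 * (‖h‖ * (μ * ε ^ 2 / 6 * ‖h‖)) := by
          gcongr
          · linarith
          · exact he.trans hv
      _ = _ := by ring
  have hshrink : μ * ε ^ 2 * ‖h - ⟪ℓ, h⟫ • ℓ‖ ^ 2 ≤ μ * 1 * ‖h - ⟪ℓ, h⟫ • ℓ‖ ^ 2 := by gcongr
  rw [inner_neg_right, inner_neg_right, inner_add_right, inner_add_right,
    inner_apply_eq_zero hA hAℓ, zero_add, coneForm]
  rw [hpyth] at hradial haxial ⊢
  linarith

lemma transverse_le_of_coercive (hA : A.IsPositive) (hAℓ : A ℓ = 0) (hℓ : ‖ℓ‖ = 1)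
    (hcoer : μ * ‖h - ⟪ℓ, h⟫ • ℓ‖ ^ 2 ≤ ⟪h, A h⟫) (hμ : 0 ≤ μ) (hε : 0 < ε) (hε₁ : ε ≤ 1)
    (hv : ‖v - A h‖ ≤ μ * ε ^ 2 / 6 * ‖h‖) (hh : 0 ≤ coneForm ε ℓ h) :
    μ * ε / 4 * ‖h‖ ≤ ‖v‖ := by
  set y := h - ⟪ℓ, h⟫ • ℓ with hy
  have hpyth : ‖h‖ ^ 2 = ⟪ℓ, h⟫ ^ 2 + ‖y‖ ^ 2 := norm_sq_eq_inner_sq_add hℓ h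
  have hyh : ε * ‖h‖ ≤ 3 / 2 * ‖y‖ := by
    have hε₂ : ε ^ 2 * ‖y‖ ^ 2 ≤ 1 * ‖y‖ ^ 2 := by gcongr; exact pow_le_one₀ hε.le hε₁
    rw [coneForm] at hh
    refine abs_le_of_sq_le_sq' ?_ (by positivity) |>.2
    rw [mul_pow, mul_pow, hpyth]
    linarith [sq_nonneg ‖y‖]
  have herr : ‖v - A h‖ ≤ μ / 4 * ‖y‖ :=
    calc _ ≤ μ * ε / 6 * (ε * ‖h‖) := hv.trans_eq (by ring)
      _ ≤ μ * 1 / 6 * (3 / 2 * ‖y‖) := by gcongr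
      _ = _ := by ring
  have hinner : μ * ‖y‖ * ‖y‖ ≤ (‖v‖ + μ / 4 * ‖y‖) * ‖y‖ := by
    have hyA : ⟪y, A h⟫ = ⟪h, A h⟫ := by
      rw [hy, inner_sub_left, real_inner_smul_left, inner_apply_eq_zero hA hAℓ, mul_zero, sub_zero]
    calc _ ≤ ⟪y, A h⟫ := by rw [hyA, mul_assoc, ← sq]; exact hcoer
      _ = ⟪y, v⟫ - ⟪y, v - A h⟫ := by rw [inner_sub_right]; ring
      _ ≤ ‖y‖ * ‖v‖ + ‖y‖ * ‖v - A h‖ := by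
        have h₁ := real_inner_le_norm y v
        have h₂ := neg_le_of_abs_le (abs_real_inner_le_norm y (v - A h))
        linarith
      _ ≤ ‖y‖ * ‖v‖ + ‖y‖ * (μ / 4 * ‖y‖) := by gcongr
      _ = _ := by ring
  rcases (norm_nonneg y).eq_or_lt with hy0 | hy0
  · have hnorm : ‖h‖ ≤ 0 := by rw [← hy0, mul_zero] at hyh; nlinarith
    exact (mul_nonpos_of_nonneg_of_nonpos (by positivity) hnorm).trans (norm_nonneg v)
  · have hmain := le_of_mul_le_mul_right hinner hy0
    calc μ * ε / 4 * ‖h‖ = μ / 4 * (ε * ‖h‖) := by ring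
      _ ≤ μ / 4 * (3 / 2 * ‖y‖) := by gcongr
      _ ≤ ‖v‖ := by nlinarith [mul_nonneg hμ hy0.le]

lemma inner_quadratic_le_of_coneForm_nonpos {D : E →L[ℝ] E →L[ℝ] E} {c : ℝ} (hℓ : ‖ℓ‖ = 1)
    (hc : ⟪ℓ, D ℓ ℓ⟫ = -c) (hε : 0 ≤ ε) (hε₁ : ε ≤ 1) (hεD : ε * (3 * ‖D‖) ≤ c / 2)
    (hh : coneForm ε ℓ h ≤ 0) : ⟪ℓ, D h h⟫ ≤ -(c / 2) * ⟪ℓ, h⟫ ^ 2 := by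
  set z := ⟪ℓ, h⟫
  obtain ⟨y, hy⟩ : ∃ y, h = z • ℓ + y := ⟨h - z • ℓ, by abel⟩
  have hyz : ‖y‖ ≤ ε * |z| := by
    have hpyth : ‖h‖ ^ 2 = z ^ 2 + ‖y‖ ^ 2 := by
      rw [norm_sq_eq_inner_sq_add hℓ h, sub_eq_iff_eq_add'.2 hy]
    rw [coneForm] at hh
    refine abs_le_of_sq_le_sq' ?_ (by positivity) |>.2
    rw [mul_pow, sq_abs]
    linarith
  have hyz' : ‖y‖ ≤ |z| := hyz.trans (mul_le_of_le_one_left (abs_nonneg z) hε₁)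
  have hsplit : D h h = z ^ 2 • D ℓ ℓ + (z • D ℓ y + z • D y ℓ + D y y) := by
    rw [hy]
    simp only [map_add, map_smul, add_apply, smul_apply]
    module
  have hrest : ‖z • D ℓ y + z • D y ℓ + D y y‖ ≤ ε * (3 * ‖D‖) * z ^ 2 := by
    have hℓy : ‖D ℓ y‖ ≤ ‖D‖ * ‖y‖ := by simpa [hℓ] using D.le_opNorm₂ ℓ y
    have hyℓ : ‖D y ℓ‖ ≤ ‖D‖ * ‖y‖ := by simpa [hℓ] using D.le_opNorm₂ y ℓ
    calc _ ≤ |z| * ‖D ℓ y‖ + |z| * ‖D y ℓ‖ + ‖D y y‖ := by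
          simpa only [norm_smul, Real.norm_eq_abs] using
            norm_add₃_le (a := z • D ℓ y) (b := z • D y ℓ) (c := D y y)
      _ ≤ |z| * (‖D‖ * ‖y‖) + |z| * (‖D‖ * ‖y‖) + ‖D‖ * ‖y‖ * |z| := by
          gcongr
          exact (D.le_opNorm₂ y y).trans (by gcongr)
      _ = 3 * ‖D‖ * |z| * ‖y‖ := by ring
      _ ≤ 3 * ‖D‖ * |z| * (ε * |z|) := by gcongr
      _ = ε * (3 * ‖D‖) * z ^ 2 := by rw [← sq_abs z]; ring
  have hinner := real_inner_le_norm ℓ (z • D ℓ y + z • D y ℓ + D y y)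
  rw [hℓ, one_mul] at hinner
  rw [hsplit, inner_add_right, real_inner_smul_right, hc]
  nlinarith [mul_le_mul_of_nonneg_right hεD (sq_nonneg z)]

lemma drift_le_of_taylor {D : E →L[ℝ] E →L[ℝ] E} {c : ℝ} (hA : A.IsPositive) (hAℓ : A ℓ = 0)
    (hℓ : ‖ℓ‖ = 1) (hc : ⟪ℓ, D ℓ ℓ⟫ = -c) (hc₀ : 0 ≤ c) (hε : 0 ≤ ε) (hε₁ : ε ≤ 1)
    (hεD : ε * (3 * ‖D‖) ≤ c / 2)
    (hv : ‖v - A h - (1 / 2 : ℝ) • D h h‖ ≤ c / 16 * ‖h‖ ^ 2) (hh : coneForm ε ℓ h ≤ 0) :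
    c / 8 * ⟪ℓ, h⟫ ^ 2 ≤ ⟪ℓ, -v⟫ := by
  obtain ⟨e, rfl⟩ : ∃ e, v = A h + (1 / 2 : ℝ) • D h h + e :=
    ⟨v - A h - (1 / 2 : ℝ) • D h h, by abel⟩
  rw [show A h + (1 / 2 : ℝ) • D h h + e - A h - (1 / 2 : ℝ) • D h h = e by abel] at hv
  have hquad := inner_quadratic_le_of_coneForm_nonpos hℓ hc hε hε₁ hεD hh
  have he : ⟪ℓ, e⟫ ≤ c / 16 * (2 * ⟪ℓ, h⟫ ^ 2) :=
    calc ⟪ℓ, e⟫ ≤ ‖e‖ := by simpa [hℓ] using real_inner_le_norm ℓ e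
      _ ≤ c / 16 * ‖h‖ ^ 2 := hv
      _ ≤ _ := by gcongr; exact norm_sq_le_of_coneForm_nonpos hε hε₁ hh
  rw [inner_neg_right, inner_add_right, inner_add_right, inner_apply_eq_zero hA hAℓ,
    real_inner_smul_right]
  linarith

lemma exists_pos_le_one_mul_le {a b : ℝ} (ha : 0 ≤ a) (hb : 0 < b) :
    ∃ ε : ℝ, 0 < ε ∧ ε ≤ 1 ∧ ε * a ≤ b := by
  refine ⟨min 1 (b / (a + 1)), by positivity, min_le_left _ _, ?_⟩
  calc _ ≤ b / (a + 1) * (a + 1) := by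
        gcongr
        · exact min_le_right _ _
        · linarith
    _ = b := by field_simp

theorem exists_isFold [ProperSpace E] {F : E → E} (hF : ContDiff ℝ 2 F) {ξ : E} (hzero : F ξ = 0)
    (hℓ : ‖ℓ‖ = 1) (hA : (fderiv ℝ F ξ).IsPositive)
    (hker : (fderiv ℝ F ξ).ker = Submodule.span ℝ {ℓ})
    (hcubic : ⟪ℓ, fderiv ℝ (fderiv ℝ F) ξ ℓ ℓ⟫ < 0) :
    ∃ μ ε r κ, IsFold (fun x => -F x) ξ ℓ μ ε r κ := by
  obtain ⟨c, hc⟩ : ∃ c, ⟪ℓ, fderiv ℝ (fderiv ℝ F) ξ ℓ ℓ⟫ = -c := ⟨_, (neg_neg _).symm⟩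
  have hcpos : 0 < c := by linarith
  have hAℓ : fderiv ℝ F ξ ℓ = 0 :=
    LinearMap.mem_ker.1 (hker ▸ Submodule.mem_span_singleton_self ℓ)
  obtain ⟨μ, hμ, hcoer⟩ := exists_coercive_of_ker_eq_span hA hℓ hker
  obtain ⟨ε, hε, hε₁, hεD⟩ := exists_pos_le_one_mul_le
    (a := 3 * ‖fderiv ℝ (fderiv ℝ F) ξ‖) (by positivity) (half_pos hcpos)
  set η : NNReal := ⟨μ * ε ^ 2 / 6, by positivity⟩
  have hη : 0 < η := show 0 < μ * ε ^ 2 / 6 by positivity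
  obtain ⟨s, hs, hlin⟩ := (hF.contDiffAt.hasStrictFDerivAt (x := ξ)
    two_ne_zero).approximates_deriv_on_nhds (Or.inr hη)
  obtain ⟨r, hr, hball⟩ := Metric.mem_nhds_iff.1 (inter_mem hs
    (eventually_taylor_two_le hF ξ (show 0 < c / 16 by positivity)))
  refine ⟨μ, ε, r, c / 8, by rw [hzero, neg_zero], hℓ, hμ, hε, hε₁, hr, by positivity,
    fun x hx y hy => ?_, fun x hx hcone => ?_, fun x hx hcone => ?_⟩
  · rw [neg_sub_neg, ← neg_sub (F x)]
    exact cone_le_of_coercive hA hAℓ hℓ (hcoer _) hμ.le hε.le hε₁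
      (hlin x (hball hx).1 y (hball hy).1)
  · have htaylor := (hball hx).2
    rw [mem_ofPred_eq, hzero, sub_zero] at htaylor
    exact drift_le_of_taylor hA hAℓ hℓ hc hcpos.le hε.le hε₁ hεD htaylor hcone
  · have hlin' := hlin x (hball hx).1 ξ (mem_of_mem_nhds hs)
    rw [hzero, sub_zero] at hlin'
    rw [norm_neg]
    exact transverse_le_of_coercive hA hAℓ hℓ (hcoer _) hμ.le hε hε₁ hlin' hcone

end FoldEstimates

section FoldTimeDeriv

open scoped RealInnerProductSpace
open Asymptotics

variable {E : Type*} [NormedAddCommGroup E]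

lemma isLittleO_slice_sub_smul_of_zeros [NormedSpace ℝ E] {F : ℝ → E → E} {τ : ℝ} {ξ : E}
    {D : ℝ × E →L[ℝ] E} (hD : HasStrictFDerivAt (Function.uncurry F) D (τ, ξ)) {l : Filter ℝ}
    (hl : l ≤ 𝓝 τ) {u : ℝ → E} (hu : Tendsto u l (𝓝 ξ)) (hzero : ∀ᶠ t in l, F t (u t) = 0) :
    (fun t => F τ (u t) - (τ - t) • D (1, 0)) =o[l] fun t => τ - t := by
  have hpair : Tendsto (fun t => ((t, u t), (τ, u t))) l (𝓝 ((τ, ξ), (τ, ξ))) :=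
    ((tendsto_id.mono_left hl).prodMk_nhds hu).prodMk_nhds (tendsto_const_nhds.prodMk_nhds hu)
  have hnorm : (fun t => ((t, u t) : ℝ × E) - (τ, u t)) =O[l] fun t => τ - t :=
    .of_bound 1 <| .of_forall fun t => by simp [Prod.norm_def, abs_sub_comm]
  refine ((hD.isLittleO.comp_tendsto hpair).trans_isBigO hnorm).neg_left.congr' ?_ .rfl
  filter_upwards [hzero] with t ht
  have hDt : D (t - τ, 0) = (t - τ) • D (1, 0) := by rw [← map_smul]; simp
  simp only [Function.comp_apply, Function.uncurry_apply_pair, ht, Prod.mk_sub_mk, sub_self, hDt]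
  module

lemma isLittleO_fderiv_of_zeros [NormedSpace ℝ E] {F : ℝ → E → E} {τ : ℝ} {ξ : E}
    {D : ℝ × E →L[ℝ] E} (hD : HasFDerivAt (Function.uncurry F) D (τ, ξ)) (hξ : F τ ξ = 0)
    {l : Filter ℝ} (hl : l ≤ 𝓝 τ) {u : ℝ → E} (hu : Tendsto u l (𝓝 ξ))
    (hzero : ∀ᶠ t in l, F t (u t) = 0) :
    (fun t => D (t - τ, u t - ξ)) =o[l] fun t => ((t - τ, u t - ξ) : ℝ × E) := by
  have hpair : Tendsto (fun t => (t, u t)) l (𝓝 (τ, ξ)) :=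
    (tendsto_id.mono_left hl).prodMk_nhds hu
  refine (hD.isLittleO.comp_tendsto hpair).neg_left.congr' ?_ .rfl
  filter_upwards [hzero] with t ht
  simp [ht, hξ, -map_sub]

variable [InnerProductSpace ℝ E]

lemma IsFold.coneForm_nonneg {V : E → E} {ξ ℓ x : E} {μ ε r κ : ℝ} (hV : IsFold V ξ ℓ μ ε r κ)
    (hx : x ∈ Metric.ball ξ r) (hneg : ⟪ℓ, V x⟫ < 0) : 0 ≤ coneForm ε ℓ (x - ξ) :=
  le_of_not_ge fun hcone => hneg.not_ge <|
    (mul_nonneg hV.kappa_pos.le (sq_nonneg _)).trans (hV.drift x hx hcone)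

/- If `⟪ℓ, D (1, 0)⟫` were positive, the flow component along `ℓ` would be negative at `u t`, so
that `u t` would lie off the cone; there `u t - ξ = O(τ - t)` by transversality, and the first order
expansion at `(τ, ξ)` forces `⟪ℓ, D (1, 0)⟫ = 0`. -/
theorem IsFold.inner_timeDeriv_nonpos {F : ℝ → E → E} {τ : ℝ} {ξ ℓ : E} {μ ε r κ : ℝ}
    (hF : IsFold (fun x => -F τ x) ξ ℓ μ ε r κ) {D : ℝ × E →L[ℝ] E}
    (hD : HasStrictFDerivAt (Function.uncurry F) D (τ, ξ)) (hDℓ : ∀ h, ⟪ℓ, D (0, h)⟫ = 0)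
    {u : ℝ → E} (hu : Tendsto u (𝓝[<] τ) (𝓝 ξ)) (hzero : ∀ᶠ t in 𝓝[<] τ, F t (u t) = 0) :
    ⟪ℓ, D (1, 0)⟫ ≤ 0 := by
  by_contra! ha
  have hl : 𝓝[<] τ ≤ 𝓝 τ := nhdsWithin_le_nhds
  have hslice := isLittleO_slice_sub_smul_of_zeros hD hl hu hzero
  have hpos : ∀ᶠ t in 𝓝[<] τ, 0 < ⟪ℓ, F τ (u t)⟫ := by
    filter_upwards [(((innerSL ℝ ℓ).isBigO_comp _ _).trans_isLittleO hslice).def (half_pos ha),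
      self_mem_nhdsWithin] with t ht (hlt : t < τ)
    rw [innerSL_apply_apply, inner_sub_right, real_inner_smul_right, Real.norm_eq_abs,
      Real.norm_eq_abs, abs_of_pos (sub_pos.2 hlt)] at ht
    nlinarith [neg_le_of_abs_le ht, sub_pos.2 hlt]
  have htransverse : (fun t => u t - ξ) =O[𝓝[<] τ] fun t => F τ (u t) := by
    refine .of_bound (μ * ε / 4)⁻¹ ?_
    filter_upwards [hpos, hu.eventually (Metric.ball_mem_nhds ξ hF.r_pos)] with t ht hball
    rw [inv_mul_eq_div, le_div_iff₀' (by have := hF.mu_pos; have := hF.eps_pos; positivity),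
      ← norm_neg (F τ _)]
    exact hF.transverse _ hball (hF.coneForm_nonneg hball (by rwa [inner_neg_right, neg_lt_zero]))
  have hdist : (fun t => u t - ξ) =O[𝓝[<] τ] fun t => τ - t :=
    htransverse.trans <| (hslice.isBigO.add (.of_bound ‖D (1, 0)‖ (.of_forall fun t => by
      rw [norm_smul, mul_comm]))).congr_left fun t => sub_add_cancel _ _
  have htime : (fun t => t - τ) =O[𝓝[<] τ] fun t => τ - t := (isBigO_refl _ _).neg_left.congr_left
    fun t => neg_sub _ _
  have hexpand := ((innerSL ℝ ℓ).isBigO_comp _ _).trans_isLittleO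
    ((isLittleO_fderiv_of_zeros hD.hasFDerivAt (neg_eq_zero.1 hF.zero) hl hu hzero).trans_isBigO
      (htime.prod_left hdist))
  obtain ⟨t, ht, hlt⟩ := ((hexpand.def (half_pos ha)).and self_mem_nhdsWithin).exists
  have hsplit : D (t - τ, u t - ξ) = (t - τ) • D (1, 0) + D (0, u t - ξ) := by
    rw [← map_smul, ← map_add]; simp
  rw [innerSL_apply_apply, hsplit, inner_add_right, hDℓ, add_zero, real_inner_smul_right,
    Real.norm_eq_abs, Real.norm_eq_abs, abs_mul, abs_sub_comm, abs_of_pos ha,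
    abs_of_pos (sub_pos.2 hlt)] at ht
  have : 0 < τ - t := sub_pos.2 hlt
  nlinarith

end FoldTimeDeriv

section Slices

variable {E H : Type*} {T t : ℝ} {G : ℝ → E → H} {x : E}

section Topological

variable [TopologicalSpace E] [TopologicalSpace H]

lemma strip_mem_nhds (ht : t ∈ Ioo 0 T) (x : E) : (Icc 0 T ×ˢ univ : Set (ℝ × E)) ∈ 𝓝 (t, x) :=
  prod_mem_nhds (Icc_mem_nhds ht.1 ht.2) univ_mem

lemma continuousOn_slice (hG : ContinuousOn (Function.uncurry G) (Icc 0 T ×ˢ univ)) (x : E) :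
    ContinuousOn (fun t => G t x) (Icc 0 T) :=
  hG.comp (f := fun t => (t, x)) (by fun_prop) fun t ht => ⟨ht, mem_univ x⟩

lemma tendsto_slice (hG : ContinuousOn (Function.uncurry G) (Icc 0 T ×ˢ univ))
    (ht : t ∈ Icc 0 T) {l : Filter ℝ} {u : ℝ → E} (hl : l ≤ 𝓝[Icc 0 T] t)
    (hu : Tendsto u l (𝓝 x)) : Tendsto (fun s => G s (u s)) l (𝓝 (G t x)) :=
  (hG (t, x) ⟨ht, mem_univ x⟩).tendsto.comp <| tendsto_nhdsWithin_iff.2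
    ⟨(tendsto_id'.2 (hl.trans nhdsWithin_le_nhds)).prodMk_nhds hu,
      (eventually_mem_nhdsWithin.filter_mono hl).mono fun _ hs => ⟨hs, mem_univ _⟩⟩

end Topological

variable [NormedAddCommGroup E] [NormedSpace ℝ E] [NormedAddCommGroup H] [NormedSpace ℝ H]

lemma uniqueDiffOn_strip (hT : 0 < T) : UniqueDiffOn ℝ (Icc 0 T ×ˢ (univ : Set E)) :=
  (uniqueDiffOn_Icc hT).prod uniqueDiffOn_univ

lemma hasFDerivAt_slice {D : ℝ × E →L[ℝ] H} (ht : t ∈ Icc 0 T)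
    (hG : HasFDerivWithinAt (Function.uncurry G) D (Icc 0 T ×ˢ univ) (t, x)) :
    HasFDerivAt (G t) (D.comp (ContinuousLinearMap.inr ℝ ℝ E)) x :=
  hasFDerivWithinAt_univ.1 <| hG.comp x (hasFDerivAt_prodMk_right t x).hasFDerivWithinAt
    fun y _ => ⟨ht, mem_univ y⟩

lemma contDiff_slice {m : WithTop ℕ∞}
    (hG : ContDiffOn ℝ m (Function.uncurry G) (Icc 0 T ×ˢ univ)) (ht : t ∈ Icc 0 T) :
    ContDiff ℝ m (G t) :=
  contDiffOn_univ.1 <| hG.comp (f := fun y : E => (t, y)) (by fun_prop)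
    fun y _ => ⟨ht, mem_univ y⟩

lemma fderiv_slice {m : WithTop ℕ∞} (hm : m ≠ 0)
    (hG : ContDiffOn ℝ m (Function.uncurry G) (Icc 0 T ×ˢ univ)) (ht : t ∈ Icc 0 T) (x : E) :
    fderiv ℝ (G t) x = (fderivWithin ℝ (Function.uncurry G) (Icc 0 T ×ˢ univ) (t, x)).comp
      (ContinuousLinearMap.inr ℝ ℝ E) :=
  (hasFDerivAt_slice ht
    (hG.differentiableOn hm (t, x) ⟨ht, mem_univ x⟩).hasFDerivWithinAt).fderiv

lemma contDiffOn_fderiv_slice (hT : 0 < T) {m k : WithTop ℕ∞} (hk : m + 1 ≤ k)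
    (hG : ContDiffOn ℝ k (Function.uncurry G) (Icc 0 T ×ˢ univ)) :
    ContDiffOn ℝ m (fun p : ℝ × E => fderiv ℝ (G p.1) p.2) (Icc 0 T ×ˢ univ) := by
  have hk₀ : k ≠ 0 := by rintro rfl; simp at hk
  exact ((hG.fderivWithin (uniqueDiffOn_strip hT) hk).clm_comp contDiffOn_const).congr
    fun p hp => fderiv_slice hk₀ hG hp.1 p.2

end Slices

section PositiveDefinite

open scoped RealInnerProductSpace

variable {E : Type*} [NormedAddCommGroup E] [InnerProductSpace ℝ E] {A : E →L[ℝ] E}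

/-- The quadratic form `v ↦ ⟪A v, v⟫` of an operator `A`, not assumed symmetric, is positive
definite. -/
def IsPosDef (A : E →L[ℝ] E) : Prop := ∀ v, v ≠ 0 → 0 < ⟪A v, v⟫

lemma mul_norm_le_of_coercive {m : ℝ} (hA : ∀ v, m * ‖v‖ ^ 2 ≤ ⟪A v, v⟫) (v : E) :
    m * ‖v‖ ≤ ‖A v‖ := by
  rcases (norm_nonneg v).eq_or_lt with hv | hv
  · simp [← hv]
  · refine le_of_mul_le_mul_right ?_ hv
    linarith [(hA v).trans (real_inner_le_norm _ _)]

lemma IsPosDef.injective (hA : IsPosDef A) : Function.Injective A :=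
  (injective_iff_map_eq_zero A).2 fun v hv => by
    by_contra hne
    simpa [hv] using hA v hne

variable [FiniteDimensional ℝ E]

lemma IsPosDef.exists_coercive (hA : IsPosDef A) : ∃ m > 0, ∀ v, m * ‖v‖ ^ 2 ≤ ⟪A v, v⟫ := by
  obtain ⟨m, hm, hcoer⟩ := exists_coercive_of_pos (A := A) (C := univ) isClosed_univ
    (fun _ _ _ => mem_univ _) fun y _ hy => hA y hy
  exact ⟨m, hm, fun v => hcoer v (mem_univ v)⟩

lemma IsPosDef.isInvertible (hA : IsPosDef A) : A.IsInvertible :=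
  ⟨(LinearEquiv.ofInjectiveEndo A.toLinearMap hA.injective).toContinuousLinearEquiv, by
    ext v; simp⟩

lemma isOpen_setOf_isPosDef : IsOpen {A : E →L[ℝ] E | IsPosDef A} := by
  refine Metric.isOpen_iff.2 fun A hA => ?_
  obtain ⟨m, hm, hcoer⟩ := hA.exists_coercive
  refine ⟨m, hm, fun B hB v hv => ?_⟩
  have hnorm : ‖A - B‖ < m := by rwa [← dist_eq_norm, dist_comm]
  have hdiff : ⟪(A - B) v, v⟫ ≤ ‖A - B‖ * ‖v‖ ^ 2 := calc
    ⟪(A - B) v, v⟫ ≤ ‖(A - B) v‖ * ‖v‖ := real_inner_le_norm _ _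
    _ ≤ ‖A - B‖ * ‖v‖ * ‖v‖ := by gcongr; exact (A - B).le_opNorm v
    _ = ‖A - B‖ * ‖v‖ ^ 2 := by ring
  have hlt : ‖A - B‖ * ‖v‖ ^ 2 < m * ‖v‖ ^ 2 := by
    have := norm_pos_iff.2 hv
    gcongr
  rw [sub_apply, inner_sub_left] at hdiff
  linarith [hcoer v]

end PositiveDefinite

section ImplicitZeros

variable {E : Type*} [NormedAddCommGroup E] [NormedSpace ℝ E] {f : E → E} {e : E ≃L[ℝ] E}
  {m r ρ : ℝ} {c : NNReal} {y : E}

lemma mul_norm_sub_le_of_approximatesLinearOn {A : E →L[ℝ] E} {s : Set E} {x : E}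
    (hA : ∀ v, m * ‖v‖ ≤ ‖A v‖) (hf : ApproximatesLinearOn f A s c) (hx : x ∈ s) (hy : y ∈ s) :
    (m - c) * ‖x - y‖ ≤ ‖f x - f y‖ := by
  have hsub := norm_sub_norm_le (A (x - y)) (f x - f y)
  rw [norm_sub_rev (A _)] at hsub
  linarith [hA (x - y), hf x hx y hy]

variable [CompleteSpace E]

lemma exists_zero_of_approximatesLinearOn (hm : 0 < m) (he : ∀ v, m * ‖v‖ ≤ ‖e v‖)
    (hr : 0 ≤ r) (hrρ : r < ρ)
    (hf : ApproximatesLinearOn f (e : E →L[ℝ] E) (Metric.ball y ρ) c)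
    (hy : ‖f y‖ ≤ (m - c) * r) : ∃ x ∈ Metric.ball y ρ, f x = 0 := by
  let R : (e : E →L[ℝ] E).NonlinearRightInverse :=
    { toFun := e.symm
      nnnorm := ⟨m⁻¹, by positivity⟩
      bound' := fun z => by
        change _ ≤ m⁻¹ * ‖z‖
        rw [inv_mul_eq_div, le_div_iff₀' hm]
        simpa using he (e.symm z)
      right_inv' := fun z => by simp }
  have hball := Metric.closedBall_subset_ball (x := y) hrρ
  have hzero : (0 : E) ∈ Metric.closedBall (f y) (((R.nnnorm : ℝ)⁻¹ - c) * r) := by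
    change (0 : E) ∈ Metric.closedBall (f y) ((m⁻¹⁻¹ - c) * r)
    rwa [inv_inv, mem_closedBall_iff_norm, zero_sub, norm_neg]
  obtain ⟨x, hx, hx₀⟩ := hf.surjOn_closedBall_of_nonlinearRightInverse R hr hball hzero
  exact ⟨x, hball hx, hx₀⟩

lemma exists_continuousOn_zeros {α : Type*} [TopologicalSpace α] {F : α → E → E} {J : Set α}
    (hcm : c < m) (he : ∀ v, m * ‖v‖ ≤ ‖e v‖) (hr : 0 ≤ r) (hrρ : r < ρ)
    (hF : ∀ t ∈ J, ApproximatesLinearOn (F t) (e : E →L[ℝ] E) (Metric.ball y ρ) c)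
    (hcont : ∀ x, ContinuousOn (fun t => F t x) J) (hy : ∀ t ∈ J, ‖F t y‖ ≤ (m - c) * r) :
    ∃ U : α → E, ContinuousOn U J ∧ ∀ t ∈ J, U t ∈ Metric.ball y ρ ∧ F t (U t) = 0 ∧
      ∀ x ∈ Metric.ball y ρ, F t x = 0 → x = U t := by
  have hgap : 0 < m - c := sub_pos.2 hcm
  choose! U hball hzero using fun t ht =>
    exists_zero_of_approximatesLinearOn (c.2.trans_lt hcm) he hr hrρ (hF t ht) (hy t ht)
  have hdist : ∀ t ∈ J, ∀ x ∈ Metric.ball y ρ, ‖U t - x‖ ≤ (m - c)⁻¹ * ‖F t x‖ := by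
    intro t ht x hx
    have hle := mul_norm_sub_le_of_approximatesLinearOn he (hF t ht) (hball t ht) hx
    rwa [hzero t ht, zero_sub, norm_neg, ← le_div_iff₀' hgap, ← inv_mul_eq_div] at hle
  refine ⟨U, fun t₁ ht₁ => ?_, fun t ht => ⟨hball t ht, hzero t ht, fun x hx hx₀ => ?_⟩⟩
  · have hlim : Tendsto (fun t => (m - c)⁻¹ * ‖F t (U t₁)‖) (𝓝[J] t₁) (𝓝 0) := by
      simpa [ContinuousWithinAt, hzero t₁ ht₁] using
        (hcont (U t₁) t₁ ht₁).norm.const_mul (m - c)⁻¹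
    exact tendsto_iff_norm_sub_tendsto_zero.2 <| squeeze_zero' (.of_forall fun _ => norm_nonneg _)
      (eventually_mem_nhdsWithin.mono fun t ht => hdist t ht _ (hball t₁ ht₁)) hlim
  · have hle := hdist t ht x hx
    rw [hx₀, norm_zero, mul_zero, norm_le_zero_iff] at hle
    exact (sub_eq_zero.1 hle).symm

end ImplicitZeros

section Branches

variable {E : Type*} [NormedAddCommGroup E] [InnerProductSpace ℝ E] {T : ℝ} {F : ℝ → E → E}
  {J : Set ℝ} {u v : ℝ → E}

/-- `u` is a continuous branch, over the set `J` of times, of zeros of `F t` with positive definite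
linearization. -/
structure IsBranch (F : ℝ → E → E) (J : Set ℝ) (u : ℝ → E) : Prop where
  continuousOn : ContinuousOn u J
  zero : ∀ s ∈ J, F s (u s) = 0
  pos : ∀ s ∈ J, IsPosDef (fderiv ℝ (F s) (u s))

lemma IsBranch.mono {J' : Set ℝ} (hu : IsBranch F J u) (hJ : J' ⊆ J) : IsBranch F J' u :=
  ⟨hu.continuousOn.mono hJ, fun s hs => hu.zero s (hJ hs), fun s hs => hu.pos s (hJ hs)⟩

lemma isBranch_of_locally (h : ∀ s ∈ J, ∃ v, ∃ O, IsOpen O ∧ s ∈ O ∧ IsBranch F (J ∩ O) v ∧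
    EqOn u v (J ∩ O)) : IsBranch F J u := by
  choose! v O hO hsO hv huv using h
  refine ⟨fun s hs => (continuousWithinAt_inter ((hO s hs).mem_nhds (hsO s hs))).1 <|
    ((hv s hs).continuousOn.congr (huv s hs)) s ⟨hs, hsO s hs⟩, fun s hs => ?_, fun s hs => ?_⟩
  · exact huv s hs ⟨hs, hsO s hs⟩ ▸ (hv s hs).zero s ⟨hs, hsO s hs⟩
  · exact huv s hs ⟨hs, hsO s hs⟩ ▸ (hv s hs).pos s ⟨hs, hsO s hs⟩

lemma exists_eventually_approximatesLinearOn {S : Set ℝ} {t₀ : ℝ} {y₀ : E} {c : NNReal}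
    (hc : 0 < c) (hF : ∀ t ∈ S, Differentiable ℝ (F t))
    (hcont : ContinuousWithinAt (fun p : ℝ × E => fderiv ℝ (F p.1) p.2) (S ×ˢ univ) (t₀, y₀)) :
    ∃ ρ > 0, ∀ᶠ t in 𝓝[S] t₀,
      ApproximatesLinearOn (F t) (fderiv ℝ (F t₀) y₀) (Metric.ball y₀ ρ) c := by
  have hnear := hcont.eventually (Metric.closedBall_mem_nhds _ (NNReal.coe_pos.2 hc))
  rw [nhdsWithin_prod_eq, nhdsWithin_univ] at hnear
  obtain ⟨P, hP, Q, hQ, hPQ⟩ := eventually_prod_iff.1 hnear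
  obtain ⟨ρ, hρ, hball⟩ := Metric.eventually_nhds_iff_ball.1 hQ
  refine ⟨ρ, hρ, (hP.and self_mem_nhdsWithin).mono fun t ht x hx z hz => ?_⟩
  exact (convex_ball y₀ ρ).norm_image_sub_le_of_norm_fderiv_le' (fun w _ => hF t ht.2 w)
    (fun w hw => mem_closedBall_iff_norm.1 (hPQ ht.1 (hball w hw))) hz hx

variable [FiniteDimensional ℝ E]

theorem exists_local_branch (hT : 0 < T)
    (hF : ContDiffOn ℝ 2 (Function.uncurry F) (Icc 0 T ×ˢ univ)) {t₀ : ℝ} {y₀ : E}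
    (ht₀ : t₀ ∈ Icc 0 T) (hy₀ : F t₀ y₀ = 0) (hpos : IsPosDef (fderiv ℝ (F t₀) y₀)) :
    ∃ δ > 0, ∃ ρ > 0, ∃ U : ℝ → E, U t₀ = y₀ ∧ IsBranch F (Icc 0 T ∩ Metric.ball t₀ δ) U ∧
      ∀ t ∈ Icc 0 T ∩ Metric.ball t₀ δ, ∀ x ∈ Metric.ball y₀ ρ, F t x = 0 → x = U t := by
  obtain ⟨m, hm, hcoer⟩ := hpos.exists_coercive
  obtain ⟨e, he⟩ := hpos.isInvertible
  have hem : ∀ v, m * ‖v‖ ≤ ‖e v‖ := fun v => by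
    simpa [← he] using mul_norm_le_of_coercive hcoer v
  lift m to NNReal using hm.le
  have hderiv := (contDiffOn_fderiv_slice (m := 1) hT (by norm_num) hF).continuousOn (t₀, y₀)
    ⟨ht₀, mem_univ _⟩
  obtain ⟨ρ₁, hρ₁, happrox⟩ := exists_eventually_approximatesLinearOn (half_pos hm)
    (fun t ht => (contDiff_slice hF ht).differentiable two_ne_zero) hderiv
  have hposNear := hderiv.eventually (isOpen_setOf_isPosDef.mem_nhds hpos)
  rw [nhdsWithin_prod_eq, nhdsWithin_univ] at hposNear
  obtain ⟨P, hP, Q, hQ, hPQ⟩ := eventually_prod_iff.1 hposNear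
  obtain ⟨ρ₂, hρ₂, hball⟩ := Metric.eventually_nhds_iff_ball.1 hQ
  have hρ : 0 < min ρ₁ ρ₂ := lt_min hρ₁ hρ₂
  have hgap : 0 < (m - (m / 2 : NNReal) : ℝ) := by push_cast; linarith [NNReal.coe_pos.2 hm]
  have hsmall : ∀ᶠ t in 𝓝[Icc 0 T] t₀,
      ‖F t y₀‖ ≤ (m - (m / 2 : NNReal)) * (min ρ₁ ρ₂ / 2) := by
    refine (continuousOn_slice hF.continuousOn y₀ t₀ ht₀).norm.eventually_le_const ?_
    simp only [hy₀, norm_zero]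
    positivity
  obtain ⟨δ, hδ, hsub⟩ := Metric.mem_nhdsWithin_iff.1 (happrox.and (hP.and hsmall))
  rw [inter_comm] at hsub
  obtain ⟨U, hUcont, hU⟩ := exists_continuousOn_zeros (e := e) (sub_pos.1 hgap) hem
    (half_pos hρ).le (half_lt_self hρ)
    (fun t ht => he ▸ (hsub ht).1.mono_set (Metric.ball_subset_ball (min_le_left _ _)))
    (fun x => (continuousOn_slice hF.continuousOn x).mono inter_subset_left)
    (fun t ht => (hsub ht).2.2)
  refine ⟨δ, hδ, _, hρ, U, ?_, ⟨hUcont, fun t ht => (hU t ht).2.1, fun t ht => ?_⟩,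
    fun t ht => (hU t ht).2.2⟩
  · exact ((hU t₀ ⟨ht₀, Metric.mem_ball_self hδ⟩).2.2 y₀ (Metric.mem_ball_self hρ) hy₀).symm
  · exact hPQ (hsub ht).2.1 (hball _ (Metric.ball_subset_ball (min_le_right _ _) (hU t ht).1))

theorem IsBranch.eqOn (hT : 0 < T)
    (hF : ContDiffOn ℝ 2 (Function.uncurry F) (Icc 0 T ×ˢ univ)) (hJ : J ⊆ Icc 0 T)
    (hconn : IsPreconnected J) (hu : IsBranch F J u) (hv : IsBranch F J v) {a : ℝ} (ha : a ∈ J)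
    (huv : u a = v a) : EqOn u v J := by
  have : PreconnectedSpace J := isPreconnected_iff_preconnectedSpace.1 hconn
  have hclosed : IsClosed {s : J | u s = v s} :=
    isClosed_eq hu.continuousOn.domRestrict hv.continuousOn.domRestrict
  have hopen : IsOpen {s : J | u s = v s} := by
    refine isOpen_iff_mem_nhds.2 ?_
    rintro ⟨s, hs⟩ (huvs : u s = v s)
    obtain ⟨δ, hδ, ρ, hρ, U, -, -, huniq⟩ :=
      exists_local_branch hT hF (hJ hs) (hu.zero s hs) (hu.pos s hs)
    have huball := (hu.continuousOn s hs).eventually (Metric.ball_mem_nhds _ hρ)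
    have hvball := (hv.continuousOn s hs).eventually (Metric.ball_mem_nhds _ hρ)
    rw [← huvs] at hvball
    rw [mem_nhds_subtype_iff_nhdsWithin]
    filter_upwards [huball, hvball, self_mem_nhdsWithin,
      mem_nhdsWithin_of_mem_nhds (Metric.ball_mem_nhds s hδ)] with z hzu hzv hz hzδ
    exact ⟨⟨z, hz⟩, (huniq z ⟨hJ hz, hzδ⟩ _ hzu (hu.zero z hz)).trans
      (huniq z ⟨hJ hz, hzδ⟩ _ hzv (hv.zero z hz)).symm, rfl⟩
  exact fun s hs => (IsClopen.eq_univ ⟨hclosed, hopen⟩ ⟨⟨a, ha⟩, huv⟩).ge (mem_univ ⟨s, hs⟩)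

end Branches

section BranchRegularity

variable {E : Type*} [NormedAddCommGroup E]

lemma hasDerivWithinAt_of_zeros [NormedSpace ℝ E] {H : Type*} [NormedAddCommGroup H]
    [NormedSpace ℝ H] {Ψ : ℝ × E → H} {D : ℝ × E →L[ℝ] H} {S : Set (ℝ × E)} {I : Set ℝ}
    {u : ℝ → E} {s : ℝ} (hΨ : HasFDerivWithinAt Ψ D S (s, u s))
    (hinv : (D.comp (ContinuousLinearMap.inr ℝ ℝ E)).IsInvertible)
    (hmaps : MapsTo (fun r => (r, u r)) I S) (hu : ContinuousWithinAt u I s)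
    (hzero : ∀ r ∈ I, Ψ (r, u r) = 0) (hs : s ∈ I) :
    HasDerivWithinAt u (-(D.comp (ContinuousLinearMap.inr ℝ ℝ E)).inverse (D (1, 0))) I s := by
  obtain ⟨e, he⟩ := hinv
  let L : ℝ × H →L[ℝ] ℝ × E := (ContinuousLinearMap.fst ℝ ℝ H).prod
    ((e.symm : H →L[ℝ] E).comp (ContinuousLinearMap.snd ℝ ℝ H -
      (D.comp ((ContinuousLinearMap.inl ℝ ℝ E).comp (ContinuousLinearMap.fst ℝ ℝ H)))))
  have hleft : Function.LeftInverse L ((ContinuousLinearMap.fst ℝ ℝ E).prod D) := by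
    rintro ⟨d, k⟩
    have hk : D (d, k) - D (d, 0) = e k := by
      rw [← map_sub, ← e.coe_coe, he]
      simp
    have hek : e.symm (D (d, k) - D (d, 0)) = k := by rw [hk, e.symm_apply_apply]
    rw [map_sub] at hek
    simp [L, hek]
  have hgraph : Tendsto (fun r => (r, u r)) (𝓝[I] s) (𝓝[S] (s, u s)) :=
    (continuousWithinAt_id.prodMk hu).tendsto_nhdsWithin hmaps
  have htime : HasFDerivWithinAt (fun r : ℝ => (r, (0 : H))) (ContinuousLinearMap.inl ℝ ℝ H) I s :=
    (hasFDerivAt_prodMk_left s 0).hasFDerivWithinAt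
  have hcurve := HasFDerivWithinAt.of_comp_of_leftInverse hgraph
    (hasFDerivWithinAt_fst.prodMk hΨ) htime
    (eventually_mem_nhdsWithin.mono fun r hr => by simp [hzero r hr]) hleft hs
  refine (hasFDerivAt_snd.comp_hasFDerivWithinAt s hcurve).hasDerivWithinAt.congr_deriv ?_
  simp [L, ← he]

variable [InnerProductSpace ℝ E]

/-- The velocity of a branch of zeros of `F t` through `p.2` at time `p.1`, as given by implicit
differentiation. The time derivative is one-sided at `0` and `T`, hence the `fderivWithin`. -/
def branchVelocity (T : ℝ) (F : ℝ → E → E) (p : ℝ × E) : E :=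
  -(fderiv ℝ (F p.1) p.2).inverse
    (fderivWithin ℝ (Function.uncurry F) (Icc 0 T ×ˢ univ) p (1, 0))

variable [FiniteDimensional ℝ E] {T : ℝ} {F : ℝ → E → E} {J : Set ℝ} {u : ℝ → E}

lemma contDiffOn_branchVelocity (hT : 0 < T) {m k : WithTop ℕ∞} (hk : m + 1 ≤ k)
    (hF : ContDiffOn ℝ k (Function.uncurry F) (Icc 0 T ×ˢ univ)) :
    ContDiffOn ℝ m (branchVelocity T F)
      {p | p ∈ Icc 0 T ×ˢ univ ∧ IsPosDef (fderiv ℝ (F p.1) p.2)} := by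
  have hsub := sep_subset (Icc 0 T ×ˢ (univ : Set E)) fun p => IsPosDef (fderiv ℝ (F p.1) p.2)
  refine ContDiffOn.neg (ContDiffOn.clm_apply (fun p hp => ?_)
    (((hF.fderivWithin (uniqueDiffOn_strip hT) hk).mono hsub).clm_apply contDiffOn_const))
  exact (hp.2.isInvertible.contDiffAt_map_inverse (𝕜 := ℝ)).comp_contDiffWithinAt p
    ((contDiffOn_fderiv_slice hT hk hF).mono hsub p hp)

lemma IsBranch.hasDerivWithinAt
    (hF : ContDiffOn ℝ 1 (Function.uncurry F) (Icc 0 T ×ˢ univ)) (hJ : J ⊆ Icc 0 T)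
    (hu : IsBranch F J u) {s : ℝ} (hs : s ∈ J) :
    HasDerivWithinAt u (branchVelocity T F (s, u s)) J s := by
  have hmaps : MapsTo (fun s => (s, u s)) J (Icc 0 T ×ˢ univ) := fun s hs =>
    ⟨hJ hs, mem_univ _⟩
  have hslice := fderiv_slice one_ne_zero hF (hmaps hs).1 (u s)
  have hderiv := hasDerivWithinAt_of_zeros
    (hF.differentiableOn one_ne_zero _ (hmaps hs)).hasFDerivWithinAt
    (hslice ▸ (hu.pos s hs).isInvertible) hmaps (hu.continuousOn s hs) hu.zero hs
  rwa [← hslice] at hderiv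

theorem IsBranch.contDiffOn (hT : 0 < T)
    (hF : ContDiffOn ℝ 2 (Function.uncurry F) (Icc 0 T ×ˢ univ)) (hJ : J ⊆ Icc 0 T)
    (huniq : UniqueDiffOn ℝ J) (hu : IsBranch F J u) : ContDiffOn ℝ 2 u J := by
  have hvel := contDiffOn_branchVelocity hT (m := 1) (by norm_num) hF
  have hderiv := fun s (hs : s ∈ J) => hu.hasDerivWithinAt (hF.of_le one_le_two) hJ hs
  have hmaps : MapsTo (fun s => (s, u s)) J
      {p | p ∈ Icc 0 T ×ˢ univ ∧ IsPosDef (fderiv ℝ (F p.1) p.2)} := fun s hs =>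
    ⟨⟨hJ hs, mem_univ _⟩, hu.pos s hs⟩
  have hdiff : DifferentiableOn ℝ u J := fun s hs => (hderiv s hs).differentiableWithinAt
  have hderivWithin : EqOn (derivWithin u J) (fun s => branchVelocity T F (s, u s))
      J := fun s hs => (hderiv s hs).derivWithin (huniq s hs)
  have hone : ContDiffOn ℝ 1 u J := (contDiffOn_one_iff_derivWithin huniq).2
    ⟨hdiff, (hvel.continuousOn.comp (continuousOn_id.prodMk hu.continuousOn) hmaps).congr
      hderivWithin⟩
  rw [← one_add_one_eq_two, contDiffOn_succ_iff_derivWithin huniq]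
  exact ⟨hdiff, by simp, (hvel.comp (contDiffOn_id.prodMk hone) hmaps).congr hderivWithin⟩

end BranchRegularity

section MaximalBranch

open scoped RealInnerProductSpace

variable {E : Type*} [NormedAddCommGroup E] [InnerProductSpace ℝ E] {T a b : ℝ} {F : ℝ → E → E}
  {J : Set ℝ} {u : ℝ → E}

lemma IsBranch.glue {d b' : ℝ} {U : ℝ → E} (hu : IsBranch F (Ico a b) u)
    (hU : IsBranch F (Ioo d b') U) (hdb : d < b) (huU : EqOn u U (Ioo d b)) :
    IsBranch F (Ico a b') fun s => if s < b then u s else U s := by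
  refine isBranch_of_locally fun s _ => ?_
  rcases lt_or_ge s b with hsb | hbs
  · exact ⟨u, Iio b, isOpen_Iio, hsb, hu.mono fun z hz => ⟨hz.1.1, hz.2⟩,
      fun z hz => if_pos hz.2⟩
  · refine ⟨U, Ioi d, isOpen_Ioi, hdb.trans_le hbs, hU.mono fun z hz => ⟨hz.2, hz.1.2⟩,
      fun z hz => ?_⟩
    simp only [ite_eq_right_iff]
    exact fun hzb => huU ⟨hz.2, hzb⟩

lemma IsBranch.zero_of_tendsto (hF : ContinuousOn (Function.uncurry F) (Icc 0 T ×ˢ univ))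
    (hJ : J ⊆ Icc 0 T) (hu : IsBranch F J u) (hb : b ∈ Icc 0 T) {l : Filter ℝ} [l.NeBot]
    (hl : l ≤ 𝓝[J] b) {x : E} (hux : Tendsto u l (𝓝 x)) : F b x = 0 :=
  tendsto_nhds_unique (tendsto_slice hF hb (hl.trans (nhdsWithin_mono b hJ)) hux) <|
    tendsto_const_nhds.congr' <| (eventually_mem_nhdsWithin.filter_mono hl).mono
      fun s hs => (hu.zero s hs).symm

lemma IsBranch.inner_nonneg_of_tendsto (hT : 0 < T)
    (hF : ContDiffOn ℝ 1 (Function.uncurry F) (Icc 0 T ×ˢ univ))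
    (hJ : J ⊆ Icc 0 T) (hu : IsBranch F J u) (hb : b ∈ Icc 0 T) {l : Filter ℝ} [l.NeBot]
    (hl : l ≤ 𝓝[J] b) {x : E} (hux : Tendsto u l (𝓝 x)) (v : E) :
    0 ≤ ⟪fderiv ℝ (F b) x v, v⟫ := by
  have hderiv : Tendsto (fun s => fderiv ℝ (F s) (u s)) l (𝓝 (fderiv ℝ (F b) x)) :=
    tendsto_slice (G := fun s y => fderiv ℝ (F s) y)
      (contDiffOn_fderiv_slice (m := 0) hT (by norm_num) hF).continuousOn hb
      (hl.trans (nhdsWithin_mono b hJ)) hux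
  have happly := ((ContinuousLinearMap.apply ℝ E v).continuous.tendsto _).comp hderiv
  refine ge_of_tendsto (happly.inner tendsto_const_nhds)
    ((eventually_mem_nhdsWithin.filter_mono hl).mono fun s hs => ?_)
  rcases eq_or_ne v 0 with rfl | hv
  · simp
  · exact (hu.pos s hs v hv).le

lemma IsBranch.exists_tendsto (hF : ContinuousOn (Function.uncurry F) (Icc 0 T ×ˢ univ))
    {K : Set E} (hK : IsCompact K) (hFK : ∀ t ∈ Icc 0 T, ∀ x, F t x = 0 → x ∈ K)
    (hab : a < b) (hJ : Ico a b ⊆ Icc 0 T) (hb : b ∈ Icc 0 T) (hcount : {x | F b x = 0}.Countable)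
    (hu : IsBranch F (Ico a b) u) : ∃ x, Tendsto u (𝓝[<] b) (𝓝 x) := by
  have hle : 𝓝[<] b ≤ 𝓝[Ico a b] b := (nhdsWithin_Ico_eq_nhdsLT hab).ge
  refine exists_tendsto_of_countable_mapClusterPt hK
    (hle <| mem_of_superset self_mem_nhdsWithin fun s hs => hFK s (hJ hs) _ (hu.zero s hs))
    (fun A hA => ?_) (hcount.mono fun p hp => ?_)
  · obtain ⟨c, hc, hcA⟩ := (mem_nhdsLT_iff_exists_Ioo_subset' hab).1 hA
    exact ⟨Ioo (max a c) b, Ioo_mem_nhdsLT (max_lt hab hc),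
      (Ioo_subset_Ioo_left (le_max_right _ _)).trans hcA, isPreconnected_Ioo,
      hu.continuousOn.mono fun s hs => ⟨(le_max_left _ _).trans hs.1.le, hs.2⟩⟩
  · obtain ⟨V, hV, hVp⟩ := mapClusterPt_iff_ultrafilter.1 hp
    exact hu.zero_of_tendsto hF hJ hb (hV.trans hle) hVp

variable [FiniteDimensional ℝ E]

lemma exists_isBranch_right (hT : 0 < T)
    (hF : ContDiffOn ℝ 2 (Function.uncurry F) (Icc 0 T ×ˢ univ)) {y₀ : E}
    (ha : a ∈ Ico 0 T) (hy₀ : F a y₀ = 0) (hpos : IsPosDef (fderiv ℝ (F a) y₀)) :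
    ∃ b ∈ Ioc a T, ∃ u, u a = y₀ ∧ IsBranch F (Ico a b) u := by
  obtain ⟨δ, hδ, -, -, U, hUa, hU, -⟩ :=
    exists_local_branch hT hF (Ico_subset_Icc_self ha) hy₀ hpos
  refine ⟨min (a + δ) T, ⟨lt_min (by linarith) ha.2, min_le_right _ _⟩, U, hUa,
    hU.mono fun s hs => ?_⟩
  rw [mem_Ico, lt_min_iff] at hs
  rw [Real.ball_eq_Ioo]
  exact ⟨⟨ha.1.trans hs.1, hs.2.2.le⟩, by linarith, hs.2.1⟩

lemma IsBranch.exists_extension (hT : 0 < T)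
    (hF : ContDiffOn ℝ 2 (Function.uncurry F) (Icc 0 T ×ˢ univ)) (ha : 0 ≤ a)
    (hab : a < b) (hb : b < T) (hu : IsBranch F (Ico a b) u) {x : E}
    (hlim : Tendsto u (𝓝[<] b) (𝓝 x)) (hx : F b x = 0) (hpos : IsPosDef (fderiv ℝ (F b) x)) :
    ∃ b' ∈ Ioc b T, ∃ v, v a = u a ∧ IsBranch F (Ico a b') v := by
  obtain ⟨δ, hδ, ρ, hρ, U, -, hU, huniq⟩ :=
    exists_local_branch hT hF ⟨ha.trans hab.le, hb.le⟩ hx hpos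
  rw [Real.ball_eq_Ioo] at hU huniq
  have hbδ : b < min (b + δ) T := lt_min (by linarith) hb
  obtain ⟨c, hcb, hball⟩ := (mem_nhdsLT_iff_exists_Ioo_subset' hab).1
    (hlim.eventually (Metric.ball_mem_nhds x hρ))
  let d := max c (max a (b - δ))
  have hcd : c ≤ d := le_max_left _ _
  have had : a ≤ d := (le_max_left _ _).trans (le_max_right _ _)
  have hδd : b - δ ≤ d := (le_max_right _ _).trans (le_max_right _ _)
  have hdb : d < b := max_lt hcb (max_lt hab (sub_lt_self b hδ))
  have hsub : Ioo d (min (b + δ) T) ⊆ Icc 0 T ∩ Ioo (b - δ) (b + δ) := fun s hs =>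
    ⟨⟨(ha.trans had).trans hs.1.le, (hs.2.trans_le (min_le_right _ _)).le⟩,
      hδd.trans_lt hs.1, hs.2.trans_le (min_le_left _ _)⟩
  have huU : EqOn u U (Ioo d b) := fun s hs =>
    huniq s (hsub ⟨hs.1, hs.2.trans hbδ⟩) _ (hball ⟨hcd.trans_lt hs.1, hs.2⟩)
      (hu.zero s ⟨had.trans hs.1.le, hs.2⟩)
  exact ⟨_, ⟨hbδ, min_le_right _ _⟩, _, if_pos hab, hu.glue (hU.mono hsub) hdb huU⟩

lemma exists_isBranch_Ico_of_forall_lt (hT : 0 < T)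
    (hF : ContDiffOn ℝ 2 (Function.uncurry F) (Icc 0 T ×ˢ univ)) (ha : 0 ≤ a) (hab : a < b)
    {y₀ : E} (hbr : ∀ s < b, ∃ c ∈ Ioc s T, ∃ u, u a = y₀ ∧ IsBranch F (Ico a c) u) :
    ∃ u, u a = y₀ ∧ IsBranch F (Ico a b) u := by
  choose! c hc W hWa hW using hbr
  refine ⟨fun s => W s s, hWa a hab, isBranch_of_locally fun s hs =>
    ⟨W s, Iio (c s), isOpen_Iio, (hc s hs.2).1, (hW s hs.2).mono fun z hz => ⟨hz.1.1, hz.2⟩,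
      fun z hz => ?_⟩⟩
  have hz' : z ∈ Ico a (min (c z) (c s)) := ⟨hz.1.1, lt_min (hc z hz.1.2).1 hz.2⟩
  exact IsBranch.eqOn hT hF
    (fun r hr => ⟨ha.trans hr.1, hr.2.le.trans ((min_le_right _ _).trans (hc s hs.2).2)⟩)
    isPreconnected_Ico ((hW z hz.1.2).mono (Ico_subset_Ico_right (min_le_left _ _)))
    ((hW s hs.2).mono (Ico_subset_Ico_right (min_le_right _ _)))
    (left_mem_Ico.2 (hz'.1.trans_lt hz'.2)) ((hWa z hz.1.2).trans (hWa s hs.2).symm) hz'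

theorem exists_maximal_branch (hT : 0 < T)
    (hF : ContDiffOn ℝ 2 (Function.uncurry F) (Icc 0 T ×ˢ univ)) {K : Set E} (hK : IsCompact K)
    (hFK : ∀ t ∈ Icc 0 T, ∀ x, F t x = 0 → x ∈ K)
    (hcount : ∀ t ∈ Icc 0 T, {x | F t x = 0}.Countable) {y₀ : E} (ha : a ∈ Ico 0 T)
    (hy₀ : F a y₀ = 0) (hpos : IsPosDef (fderiv ℝ (F a) y₀)) :
    ∃ b ∈ Ioc a T, ∃ u x, u a = y₀ ∧ IsBranch F (Ico a b) u ∧ Tendsto u (𝓝[<] b) (𝓝 x) ∧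
      F b x = 0 ∧ (∀ v, 0 ≤ ⟪fderiv ℝ (F b) x v, v⟫) ∧
      (b < T → ¬ IsPosDef (fderiv ℝ (F b) x)) := by
  let B : Set ℝ := {b | b ∈ Ioc a T ∧ ∃ u : ℝ → E, u a = y₀ ∧ IsBranch F (Ico a b) u}
  obtain ⟨b₀, hb₀⟩ : B.Nonempty := exists_isBranch_right hT hF ha hy₀ hpos
  have hbdd : BddAbove B := ⟨T, fun b hb => hb.1.2⟩
  have hsup : sSup B ∈ Ioc a T :=
    ⟨hb₀.1.1.trans_le (le_csSup hbdd hb₀), csSup_le ⟨b₀, hb₀⟩ fun b hb => hb.1.2⟩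
  have hsupT : sSup B ∈ Icc 0 T := ⟨ha.1.trans hsup.1.le, hsup.2⟩
  have hJ : Ico a (sSup B) ⊆ Icc 0 T := fun s hs => ⟨ha.1.trans hs.1, hs.2.le.trans hsup.2⟩
  obtain ⟨u, hua, hu⟩ : ∃ u, u a = y₀ ∧ IsBranch F (Ico a (sSup B)) u := by
    refine exists_isBranch_Ico_of_forall_lt hT hF ha.1 hsup.1 fun s hs => ?_
    obtain ⟨b, ⟨hb, hbr⟩, hsb⟩ := exists_lt_of_lt_csSup ⟨b₀, hb₀⟩ hs
    exact ⟨b, ⟨hsb, hb.2⟩, hbr⟩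
  obtain ⟨x, hlim⟩ := hu.exists_tendsto hF.continuousOn hK hFK hsup.1 hJ hsupT (hcount _ hsupT)
  have hle := (nhdsWithin_Ico_eq_nhdsLT hsup.1).ge
  have hx := hu.zero_of_tendsto hF.continuousOn hJ hsupT hle hlim
  refine ⟨sSup B, hsup, u, x, hua, hu, hlim, hx,
    hu.inner_nonneg_of_tendsto hT (hF.of_le one_le_two) hJ hsupT hle hlim, fun hlt hxpos => ?_⟩
  obtain ⟨b', hb', v, hva, hv⟩ := hu.exists_extension hT hF ha.1 hsup.1 hlt hlim hx hxpos
  exact (le_csSup hbdd ⟨⟨hsup.1.trans hb'.1, hb'.2⟩, v, hva.trans hua, hv⟩).not_gt hb'.1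

end MaximalBranch

section Gradient

open scoped RealInnerProductSpace

variable {E : Type*} [NormedAddCommGroup E] [InnerProductSpace ℝ E] [CompleteSpace E]
  {g : E → ℝ} {x : E} {T τ : ℝ} {f : ℝ → E → ℝ}

lemma isBoundedLinearMap_toDual_symm :
    IsBoundedLinearMap ℝ (InnerProductSpace.toDual ℝ E).symm where
  map_add := map_add _
  map_smul c L := by simp
  bound := ⟨1, one_pos, fun L => by simp⟩

lemma contDiff_gradient {m k : WithTop ℕ∞} (hk : m + 1 ≤ k) (hg : ContDiff ℝ k g) :
    ContDiff ℝ m (gradient g) :=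
  isBoundedLinearMap_toDual_symm.contDiff.comp (hg.fderiv_right hk)

lemma contDiffOn_gradient (hT : 0 < T) {m k : WithTop ℕ∞} (hk : m + 1 ≤ k)
    (hf : ContDiffOn ℝ k (Function.uncurry f) (Icc 0 T ×ˢ univ)) :
    ContDiffOn ℝ m (Function.uncurry fun t => gradient (f t)) (Icc 0 T ×ˢ univ) :=
  isBoundedLinearMap_toDual_symm.contDiff.comp_contDiffOn (contDiffOn_fderiv_slice hT hk hf)

lemma differentiable_gradient (hg : ContDiff ℝ 2 g) : Differentiable ℝ (gradient g) :=
  (contDiff_gradient (m := 1) (by norm_num) hg).differentiable one_ne_zero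

lemma inner_fderiv_gradient (hg : ContDiff ℝ 2 g) (x v w : E) :
    ⟪fderiv ℝ (gradient g) x v, w⟫ = fderiv ℝ (fderiv ℝ g) x v w := by
  have hinner : HasFDerivAt (fun y => fderiv ℝ g y w)
      ((fderivInnerCLM ℝ (gradient g x, w)).comp ((fderiv ℝ (gradient g) x).prod 0)) x := by
    simpa only [inner_gradient_left] using
      (differentiable_gradient hg x).hasFDerivAt.inner ℝ (hasFDerivAt_const w x)
  have happly := (((hg.fderiv_right (m := 1) (by norm_num)).differentiable one_ne_zero
    x).hasFDerivAt).clm_apply (hasFDerivAt_const w x)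
  simpa using DFunLike.congr_fun (hinner.unique happly) v

lemma isSymmetric_fderiv_gradient (hg : ContDiff ℝ 2 g) (x : E) :
    (fderiv ℝ (gradient g) x).IsSymmetric := fun v w => by
  simp only [ContinuousLinearMap.coe_coe]
  rw [real_inner_comm _ v, inner_fderiv_gradient hg, inner_fderiv_gradient hg]
  exact (hg.contDiffAt (x := x)).isSymmSndFDerivAt (by simp) v w

lemma inner_fderiv_uncurry_gradient
    (hf : ContDiffOn ℝ 2 (Function.uncurry f) (Icc 0 T ×ˢ univ)) (hτ : τ ∈ Ioo 0 T) (x v : E)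
    (p : ℝ × E) :
    ⟪fderiv ℝ (Function.uncurry fun t => gradient (f t)) (τ, x) p, v⟫ =
      fderiv ℝ (fderiv ℝ (Function.uncurry f)) (τ, x) p (0, v) := by
  have hgrad : DifferentiableAt ℝ (Function.uncurry fun t => gradient (f t)) (τ, x) :=
    ((contDiffOn_gradient (m := 1) (hτ.1.trans hτ.2) (by norm_num) hf).contDiffAt
      (strip_mem_nhds hτ x)).differentiableAt one_ne_zero
  have hfderiv : DifferentiableAt ℝ (fderiv ℝ (Function.uncurry f)) (τ, x) :=
    ((hf.contDiffAt (strip_mem_nhds hτ x)).fderiv_right (m := 1)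
      (by norm_num)).differentiableAt one_ne_zero
  have hinner := hgrad.hasFDerivAt.inner ℝ (hasFDerivAt_const v (τ, x))
  have happly := hfderiv.hasFDerivAt.clm_apply (hasFDerivAt_const ((0 : ℝ), v) (τ, x))
  have hpartial : (fun q : ℝ × E => ⟪gradient (f q.1) q.2, v⟫) =ᶠ[𝓝 (τ, x)]
      fun q => fderiv ℝ (Function.uncurry f) q (0, v) := by
    filter_upwards [prod_mem_nhds (Ioo_mem_nhds hτ.1 hτ.2) univ_mem] with q hq
    rw [inner_gradient_left, fderiv_slice two_ne_zero hf (Ioo_subset_Icc_self hq.1) q.2,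
      fderivWithin_of_mem_nhds (strip_mem_nhds hq.1 q.2)]
    simp
  simpa using DFunLike.congr_fun ((hinner.congr_of_eventuallyEq hpartial.symm).unique happly) p

end Gradient

section Coordinates

open scoped RealInnerProductSpace

variable {g : Rn n → ℝ} {x ℓ : Rn n} {T τ : ℝ} {f : ℝ → Rn n → ℝ}

lemma sum_smul_single (v : Rn n) : ∑ j, v j • EuclideanSpace.single j (1 : ℝ) = v := by
  simpa using (EuclideanSpace.basisFun (Fin n) ℝ).sum_repr v

lemma pderiv_eq_gradient (g : Rn n → ℝ) (i : Fin n) : pderiv i g = fun x => gradient g x i := by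
  funext x
  rw [pderiv, ← inner_gradient_left, EuclideanSpace.inner_single_right]
  simp

lemma fderiv_coordinate {F : Rn n → Rn n} (hF : DifferentiableAt ℝ F x) (v : Rn n) (i : Fin n) :
    fderiv ℝ (fun y => F y i) x v = fderiv ℝ F x v i := by
  have hproj := (EuclideanSpace.proj (𝕜 := ℝ) i).hasFDerivAt.comp x hF.hasFDerivAt
  exact DFunLike.congr_fun hproj.fderiv v

lemma pderiv_pderiv (hg : DifferentiableAt ℝ (gradient g) x) (i j : Fin n) :
    pderiv j (pderiv i g) x = fderiv ℝ (gradient g) x (EuclideanSpace.single j 1) i := by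
  rw [pderiv_eq_gradient g i, pderiv, fderiv_coordinate hg]

lemma pderiv_pderiv_pderiv (hg : ContDiff ℝ 3 g) (x : Rn n) (i j k : Fin n) :
    pderiv k (pderiv j (pderiv i g)) x = fderiv ℝ (fderiv ℝ (gradient g)) x
      (EuclideanSpace.single k 1) (EuclideanSpace.single j 1) i := by
  have hgrad : ContDiff ℝ 2 (gradient g) := contDiff_gradient (by norm_num) hg
  have hderiv := (((hgrad.fderiv_right (m := 1) (by norm_num)).differentiable one_ne_zero
    x).hasFDerivAt).clm_apply (hasFDerivAt_const (EuclideanSpace.single j (1 : ℝ)) x)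
  rw [funext fun y => pderiv_pderiv (hgrad.differentiable two_ne_zero y) i j, pderiv,
    fderiv_coordinate hderiv.differentiableAt, hderiv.fderiv]
  simp

lemma toEuclideanLin_hessian (hg : DifferentiableAt ℝ (gradient g) x) :
    Matrix.toEuclideanLin (hessian g x) = (fderiv ℝ (gradient g) x).toLinearMap := by
  refine (EuclideanSpace.basisFun (Fin n) ℝ).toBasis.ext fun j => ?_
  ext i
  simp [Matrix.toLpLin_apply, hessian, pderiv_pderiv hg]

lemma isPositive_fderiv_gradient_iff (hg : DifferentiableAt ℝ (gradient g) x) :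
    (fderiv ℝ (gradient g) x).IsPositive ↔ (hessian g x).PosSemidef := by
  rw [← Matrix.isPositive_toEuclideanLin_iff, toEuclideanLin_hessian hg,
    ContinuousLinearMap.isPositive_toLinearMap_iff]

lemma posSemidef_hessian_of_inner_nonneg (hg : ContDiff ℝ 2 g)
    (hnonneg : ∀ v, 0 ≤ ⟪fderiv ℝ (gradient g) x v, v⟫) : (hessian g x).PosSemidef :=
  (isPositive_fderiv_gradient_iff (differentiable_gradient hg x)).1 <|
    (ContinuousLinearMap.isPositive_iff _).2 ⟨isSymmetric_fderiv_gradient hg x, hnonneg⟩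

lemma posDef_hessian_iff (hg : ContDiff ℝ 2 g) :
    (hessian g x).PosDef ↔ IsPosDef (fderiv ℝ (gradient g) x) := by
  have hquad (v : Rn n) :
      star v.ofLp ⬝ᵥ (hessian g x).mulVec v.ofLp = ⟪fderiv ℝ (gradient g) x v, v⟫ := by
    rw [← ContinuousLinearMap.coe_coe, ← toEuclideanLin_hessian (differentiable_gradient hg x),
      Matrix.toLpLin_apply, EuclideanSpace.inner_eq_star_dotProduct]
    simp
  rw [Matrix.posDef_iff_dotProduct_mulVec]
  refine ⟨fun h v hv => hquad v ▸ h.2 (by simpa using hv), fun h => ⟨?_, fun v hv => ?_⟩⟩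
  · rw [← Matrix.isSymmetric_toEuclideanLin_iff,
      toEuclideanLin_hessian (differentiable_gradient hg x)]
    exact isSymmetric_fderiv_gradient hg x
  · exact (h (WithLp.toLp 2 v) (by simpa using hv)).trans_eq (hquad (WithLp.toLp 2 v)).symm

lemma det_hessian_eq_zero_iff (hg : DifferentiableAt ℝ (gradient g) x) :
    (hessian g x).det = 0 ↔ ∃ v, v ≠ 0 ∧ fderiv ℝ (gradient g) x v = 0 := by
  simp only [← ContinuousLinearMap.coe_coe, ← toEuclideanLin_hessian hg, Matrix.toLpLin_apply]
  rw [← Matrix.exists_mulVec_eq_zero_iff]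
  exact ⟨fun ⟨v, hv, hker⟩ => ⟨WithLp.toLp 2 v, by simpa using hv, by simp [hker]⟩,
    fun ⟨v, hv, hker⟩ => ⟨v.ofLp, by simpa using hv, by simpa using hker⟩⟩

lemma SpansKernel.ker_fderiv_gradient (hℓ : SpansKernel g x ℓ)
    (hg : DifferentiableAt ℝ (gradient g) x) :
    (fderiv ℝ (gradient g) x).ker = Submodule.span ℝ {ℓ} := by
  rw [← hℓ.2, toEuclideanLin_hessian hg]

lemma cubicForm_eq (hg : ContDiff ℝ 3 g) (x ℓ : Rn n) :
    cubicForm g x ℓ = ⟪ℓ, fderiv ℝ (fderiv ℝ (gradient g)) x ℓ ℓ⟫ := by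
  have hexpand : fderiv ℝ (fderiv ℝ (gradient g)) x ℓ ℓ =
      ∑ j, ∑ k, ℓ k • ℓ j • fderiv ℝ (fderiv ℝ (gradient g)) x
        (EuclideanSpace.single k 1) (EuclideanSpace.single j 1) := by
    conv_lhs => rw [← sum_smul_single ℓ]
    simp only [map_sum, map_smul, sum_apply, smul_apply, Finset.smul_sum]
    exact Finset.sum_congr rfl fun j _ => Finset.sum_congr rfl fun k _ => smul_comm _ _ _
  rw [cubicForm, PiLp.inner_apply, hexpand]
  refine Finset.sum_congr rfl fun i _ => ?_
  simp only [pderiv_pderiv_pderiv hg, WithLp.ofLp_sum, WithLp.ofLp_smul, Finset.sum_apply,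
    Pi.smul_apply, smul_eq_mul, RCLike.inner_apply, conj_trivial, Finset.sum_mul]
  exact Finset.sum_congr rfl fun j _ => Finset.sum_congr rfl fun k _ => by ring

lemma cubicForm_smul (g : Rn n → ℝ) (x ℓ : Rn n) (c : ℝ) :
    cubicForm g x (c • ℓ) = c ^ 3 * cubicForm g x ℓ := by
  simp only [cubicForm, Finset.mul_sum, PiLp.smul_apply, smul_eq_mul]
  exact Finset.sum_congr rfl fun i _ => Finset.sum_congr rfl fun j _ =>
    Finset.sum_congr rfl fun k _ => by ring

lemma timeDeriv_eq (hf : ContDiffOn ℝ 1 (Function.uncurry f) (Icc 0 T ×ˢ univ))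
    (hτ : τ ∈ Ioo 0 T) :
    timeDeriv T f τ = fun x => fderiv ℝ (Function.uncurry f) (τ, x) (1, 0) := by
  funext x
  have hcomp := (((hf.contDiffAt (strip_mem_nhds hτ x)).differentiableAt
    one_ne_zero).hasFDerivAt.comp τ (hasFDerivAt_prodMk_left τ x)).hasDerivAt
  exact hcomp.hasDerivWithinAt.derivWithin
    (uniqueDiffOn_Icc (hτ.1.trans hτ.2) τ (Ioo_subset_Icc_self hτ))

lemma mixedForm_eq (hf : ContDiffOn ℝ 2 (Function.uncurry f) (Icc 0 T ×ˢ univ))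
    (hτ : τ ∈ Ioo 0 T) (x ℓ : Rn n) :
    mixedForm T f τ x ℓ =
      ⟪ℓ, fderiv ℝ (Function.uncurry fun t => gradient (f t)) (τ, x) (1, 0)⟫ := by
  have hat : ContDiffAt ℝ 2 (Function.uncurry f) (τ, x) := hf.contDiffAt (strip_mem_nhds hτ x)
  have hderiv := ((((hat.fderiv_right (m := 1) (by norm_num)).differentiableAt
    one_ne_zero).hasFDerivAt).comp x (hasFDerivAt_prodMk_right τ x)).clm_apply
      (hasFDerivAt_const ((1 : ℝ), (0 : Rn n)) x)
  have hmixed : mixedForm T f τ x ℓ =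
      fderiv ℝ (fderiv ℝ (Function.uncurry f)) (τ, x) (0, ℓ) (1, 0) := by
    rw [mixedForm, inner_gradient_left, timeDeriv_eq (hf.of_le (by norm_num)) hτ]
    simpa using DFunLike.congr_fun hderiv.fderiv ℓ
  rw [hmixed, real_inner_comm, inner_fderiv_uncurry_gradient hf hτ]
  exact hat.isSymmSndFDerivAt (by simp) (0, ℓ) (1, 0)

lemma mixedForm_smul (T : ℝ) (f : ℝ → Rn n → ℝ) (τ : ℝ) (ξ ℓ : Rn n) (c : ℝ) :
    mixedForm T f τ ξ (c • ℓ) = c * mixedForm T f τ ξ ℓ := real_inner_smul_right _ _ _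

end Coordinates

section InwardFields

open scoped RealInnerProductSpace

variable {E : Type*} [NormedAddCommGroup E] [InnerProductSpace ℝ E]
  {V : E → E} {w : ℝ → E} {ξ ℓ : E} {R μ ε r κ : ℝ}

lemma mapsTo_closedBall_of_inner_neg (hw : IsIntegralCurve w fun _ => V) (hR : 0 ≤ R)
    (hV : ∀ x, ‖x‖ = R → ⟪x, V x⟫ < 0) (hw₀ : w 0 ∈ Metric.closedBall 0 R) :
    MapsTo w (Ici 0) (Metric.closedBall 0 R) := by
  intro s hs
  have hderiv (t : ℝ) : HasDerivAt (fun t => ‖w t‖ ^ 2) (2 * ⟪w t, V (w t)⟫) t := (hw t).norm_sq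
  have hsq : ‖w s‖ ^ 2 ≤ R ^ 2 := image_le_of_deriv_right_lt_deriv_boundary
    (fun t _ => (hderiv t).continuousAt.continuousWithinAt) (fun t _ => (hderiv t).hasDerivWithinAt)
    (pow_le_pow_left₀ (norm_nonneg _) (mem_closedBall_zero_iff.1 hw₀) 2)
    (fun t => hasDerivAt_const t (R ^ 2))
    (fun t _ ht => by linarith [hV (w t) ((sq_eq_sq₀ (norm_nonneg _) hR).1 ht)])
    (right_mem_Icc.2 hs)
  exact mem_closedBall_zero_iff.2 ((sq_le_sq₀ (norm_nonneg _) hR).1 hsq)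

variable [FiniteDimensional ℝ E]

lemma exists_lipschitzWith_eqOn_closedBall (hV : ContDiff ℝ 1 V) (hR : 0 < R) :
    ∃ W K, ContDiff ℝ 1 W ∧ LipschitzWith K W ∧ EqOn V W (Metric.closedBall 0 R) := by
  let χ : ContDiffBump (0 : E) := ⟨R, R + 1, hR, by linarith⟩
  have hW : ContDiff ℝ 1 fun x => χ x • V x := χ.contDiff.smul hV
  obtain ⟨K, hK⟩ :=
    hW.lipschitzWith_of_hasCompactSupport χ.hasCompactSupport.smul_right one_ne_zero
  exact ⟨_, K, hW, hK, fun x hx => by simp [χ.one_of_mem_closedBall hx]⟩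

lemma IsFold.exists_isIntegralCurve_of_inward (hV : IsFold V ξ ℓ μ ε r κ) (hV₁ : ContDiff ℝ 1 V)
    (hin : ∀ x, R ≤ ‖x‖ → ⟪x, V x⟫ < 0) :
    ∃ w, (IsIntegralCurve w fun _ => V) ∧ w 0 ≠ ξ ∧ Tendsto w atBot (𝓝 ξ) ∧
      ∃ R', MapsTo w (Ici 0) (Metric.closedBall 0 R') := by
  obtain ⟨R', hRR', hR', hsub⟩ :
      ∃ R', R ≤ R' ∧ 0 < R' ∧ Metric.ball ξ r ⊆ Metric.closedBall 0 R' := by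
    refine ⟨max R (‖ξ‖ + r), le_max_left _ _,
      lt_max_of_lt_right (add_pos_of_nonneg_of_pos (norm_nonneg ξ) hV.r_pos), fun x hx => ?_⟩
    rw [mem_ball_iff_norm] at hx
    refine mem_closedBall_zero_iff.2 (le_max_of_le_right ?_)
    linarith [norm_le_norm_add_norm_sub' x ξ]
  obtain ⟨W, K, hW, hK, hVW⟩ := exists_lipschitzWith_eqOn_closedBall hV₁ hR'
  obtain ⟨w, hw, hw₀, hpast, hlim⟩ :=
    (hV.congr (hVW.mono hsub)).exists_isIntegralCurve_tendsto hW hK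
  have hfuture := mapsTo_closedBall_of_inner_neg hw hR'.le
    (fun x hx => hVW (mem_closedBall_zero_iff.2 hx.le) ▸ hin x (hRR'.trans_eq hx.symm))
    (hsub (hpast self_mem_Iic))
  refine ⟨w, fun s => ?_, hw₀, hlim, R', hfuture⟩
  have hws : w s ∈ Metric.closedBall 0 R' :=
    (le_total s 0).elim (fun hs => hsub (hpast hs)) fun hs => hfuture hs
  simpa only [hVW hws] using hw s

end InwardFields

section Critical

open scoped RealInnerProductSpace

variable {T : ℝ} {f : ℝ → Rn n → ℝ} {g : Rn n → ℝ} {ξ ℓ : Rn n}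

lemma countable_zeros_of_injective_fderiv {E : Type*} [NormedAddCommGroup E] [NormedSpace ℝ E]
    [FiniteDimensional ℝ E] {F : E → E} (hF : Differentiable ℝ F) :
    {x | F x = 0 ∧ Function.Injective (fderiv ℝ F x)}.Countable := by
  refine (HereditarilyLindelofSpace.isLindelof _).countable_of_isDiscrete ?_
  rw [isDiscrete_iff_nhdsNE]
  intro x hx
  obtain ⟨K, -, hK⟩ := LinearMap.exists_antilipschitzWith (fderiv ℝ F x).toLinearMap
    (LinearMap.ker_eq_bot.2 hx.2)
  rw [← disjoint_iff, Filter.disjoint_principal_right]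
  filter_upwards [(hF x).hasFDerivAt.eventually_ne (c := 0) ⟨K, hK⟩] with y hy hyN using hy hyN.1

lemma countable_critical (hg : ContDiff ℝ 2 g)
    (hdegenerate : {x | gradient g x = 0 ∧ (hessian g x).det = 0}.Countable) :
    {x | gradient g x = 0}.Countable := by
  refine ((countable_zeros_of_injective_fderiv (differentiable_gradient hg)).union
    hdegenerate).mono fun x hx => ?_
  by_cases hdet : (hessian g x).det = 0
  · exact Or.inr ⟨hx, hdet⟩
  · refine Or.inl ⟨hx, (injective_iff_map_eq_zero _).2 fun v hv => by_contra fun hv₀ => hdet ?_⟩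
    exact (det_hessian_eq_zero_iff (differentiable_gradient hg x)).2 ⟨v, hv₀, hv⟩

lemma SmoothCoercive.contDiff_three (h : SmoothCoercive T f) {t : ℝ} (ht : t ∈ Icc 0 T) :
    ContDiff ℝ 3 (f t) := contDiff_slice h.1 ht

lemma SmoothCoercive.contDiff_two (h : SmoothCoercive T f) {t : ℝ} (ht : t ∈ Icc 0 T) :
    ContDiff ℝ 2 (f t) := (h.contDiff_three ht).of_le (by norm_num)

lemma SmoothCoercive.contDiff_gradient (h : SmoothCoercive T f) {t : ℝ} (ht : t ∈ Icc 0 T) :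
    ContDiff ℝ 1 (gradient (f t)) :=
  GradFlow.contDiff_gradient (by norm_num) (h.contDiff_two ht)

lemma SmoothCoercive.contDiffOn_gradient (hT : 0 < T) (h : SmoothCoercive T f) :
    ContDiffOn ℝ 2 (Function.uncurry fun t => gradient (f t)) (Icc 0 T ×ˢ univ) :=
  GradFlow.contDiffOn_gradient hT (by norm_num) h.1

lemma SmoothCoercive.exists_inner_gradient_pos (h : SmoothCoercive T f) :
    ∃ R, ∀ t ∈ Icc 0 T, ∀ x, R ≤ ‖x‖ → 0 < ⟪gradient (f t) x, x⟫ := by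
  obtain ⟨a₀, c₀, ha₀, hc₀, hcoercive⟩ := h.2
  refine ⟨a₀ / c₀ + 1, fun t ht x hx => ?_⟩
  have hratio : 0 ≤ a₀ / c₀ := by positivity
  have hsq : a₀ < c₀ * ‖x‖ ^ 2 := (div_lt_iff₀' hc₀).1 (by nlinarith)
  linarith [hcoercive t ht x]

lemma SmoothCoercive.exists_critical_subset_closedBall (h : SmoothCoercive T f) :
    ∃ R, ∀ t ∈ Icc 0 T, ∀ x, gradient (f t) x = 0 → x ∈ Metric.closedBall 0 R := by
  obtain ⟨R, hR⟩ := h.exists_inner_gradient_pos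
  refine ⟨R, fun t ht x hx => mem_closedBall_zero_iff.2 (le_of_not_ge fun hRx => ?_)⟩
  simpa [hx] using hR t ht x hRx

lemma SmoothCoercive.countable_critical (h : SmoothCoercive T f)
    (hinj : InjOn Prod.fst (degenerateSet T f)) {t : ℝ} (ht : t ∈ Icc 0 T) :
    {x | gradient (f t) x = 0}.Countable := by
  refine GradFlow.countable_critical (h.contDiff_two ht) (Set.Subsingleton.countable ?_)
  exact fun x hx y hy => congrArg Prod.snd
    (hinj (x₁ := (t, x)) (x₂ := (t, y)) ⟨⟨ht, hx.1⟩, hx.2⟩ ⟨⟨ht, hy.1⟩, hy.2⟩ rfl)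

lemma SpansKernel.smul {c : ℝ} (hc : c ≠ 0) (hℓ : SpansKernel g ξ ℓ) :
    SpansKernel g ξ (c • ℓ) :=
  ⟨smul_ne_zero hc hℓ.1, by rw [hℓ.2, Submodule.span_singleton_smul_eq (IsUnit.mk0 c hc)]⟩

lemma exists_smul_norm_eq_one_cubicForm_neg (hℓ : ℓ ≠ 0) (hc : cubicForm g ξ ℓ ≠ 0) :
    ∃ c : ℝ, c ≠ 0 ∧ ‖c • ℓ‖ = 1 ∧ cubicForm g ξ (c • ℓ) < 0 := by
  have hinv : 0 < ‖ℓ‖⁻¹ := inv_pos.2 (norm_pos_iff.2 hℓ)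
  simp only [cubicForm_smul, norm_smul, Real.norm_eq_abs]
  rcases hc.lt_or_gt with hneg | hpos
  · refine ⟨‖ℓ‖⁻¹, hinv.ne', ?_, mul_neg_of_pos_of_neg (pow_pos hinv 3) hneg⟩
    rw [abs_of_pos hinv, inv_mul_cancel₀ (norm_ne_zero_iff.2 hℓ)]
  · refine ⟨-‖ℓ‖⁻¹, (neg_lt_zero.2 hinv).ne, ?_,
      mul_neg_of_neg_of_pos (Odd.pow_neg (by decide) (neg_lt_zero.2 hinv)) hpos⟩
    rw [abs_neg, abs_of_pos hinv, inv_mul_cancel₀ (norm_ne_zero_iff.2 hℓ)]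

lemma exists_isFold_gradient (hg : ContDiff ℝ 3 g) (hξ : gradient g ξ = 0)
    (hpsd : (hessian g ξ).PosSemidef) (hℓ : SpansKernel g ξ ℓ) (hunit : ‖ℓ‖ = 1)
    (hcubic : cubicForm g ξ ℓ < 0) :
    ∃ μ ε r κ, IsFold (fun x => -gradient g x) ξ ℓ μ ε r κ := by
  have hgrad : ContDiff ℝ 2 (gradient g) := contDiff_gradient (by norm_num) hg
  have hd := hgrad.differentiable two_ne_zero ξ
  exact exists_isFold hgrad hξ hunit ((isPositive_fderiv_gradient_iff hd).2 hpsd)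
    (hℓ.ker_fderiv_gradient hd) (cubicForm_eq hg ξ ℓ ▸ hcubic)

lemma exists_smul_isFold_gradient (hg : ContDiff ℝ 3 g) (hξ : gradient g ξ = 0)
    (hpsd : (hessian g ξ).PosSemidef) (hℓ : SpansKernel g ξ ℓ) (hcubic : cubicForm g ξ ℓ ≠ 0) :
    ∃ c : ℝ, c ≠ 0 ∧ cubicForm g ξ (c • ℓ) < 0 ∧
      ∃ μ ε r κ, IsFold (fun x => -gradient g x) ξ (c • ℓ) μ ε r κ := by
  obtain ⟨c, hc, hunit, hneg⟩ := exists_smul_norm_eq_one_cubicForm_neg hℓ.1 hcubic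
  exact ⟨c, hc, hneg, exists_isFold_gradient hg hξ hpsd (hℓ.smul hc) hunit hneg⟩

lemma exists_isGradientFlow_of_degenerate {R : ℝ} (hg : ContDiff ℝ 3 g)
    (hin : ∀ x, R ≤ ‖x‖ → 0 < ⟪gradient g x, x⟫) (hξ : gradient g ξ = 0)
    (hpsd : (hessian g ξ).PosSemidef) (hℓ : SpansKernel g ξ ℓ) (hcubic : cubicForm g ξ ℓ ≠ 0) :
    ∃ w, IsGradientFlow g w ∧ (∃ s, w s ≠ ξ) ∧ Tendsto w atBot (𝓝 ξ) ∧
      ∃ R', MapsTo w (Ici 0) (Metric.closedBall 0 R') := by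
  obtain ⟨_, -, -, _, _, _, _, hfold⟩ := exists_smul_isFold_gradient hg hξ hpsd hℓ hcubic
  obtain ⟨w, hw, hw₀, hlim, hbounded⟩ := hfold.exists_isIntegralCurve_of_inward
    (contDiff_gradient (by norm_num) hg).neg (R := R) fun x hx => by
      simpa [real_inner_comm] using hin x hx
  exact ⟨w, hw, ⟨0, hw₀⟩, hlim, hbounded⟩

lemma IsGradientFlow.eq_comp_add_of_tendsto (hg : ContDiff ℝ 3 g) (hξ : gradient g ξ = 0)
    (hpsd : (hessian g ξ).PosSemidef) (hℓ : SpansKernel g ξ ℓ) (hcubic : cubicForm g ξ ℓ ≠ 0)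
    {w₁ w₂ : ℝ → Rn n} (h₁ : IsGradientFlow g w₁) (hne₁ : ∃ s, w₁ s ≠ ξ)
    (hlim₁ : Tendsto w₁ atBot (𝓝 ξ)) (h₂ : IsGradientFlow g w₂) (hne₂ : ∃ s, w₂ s ≠ ξ)
    (hlim₂ : Tendsto w₂ atBot (𝓝 ξ)) : ∃ c, ∀ s, w₁ s = w₂ (s + c) := by
  obtain ⟨_, -, -, _, _, _, _, hfold⟩ := exists_smul_isFold_gradient hg hξ hpsd hℓ hcubic
  exact hfold.eq_comp_add_of_tendsto (contDiff_gradient (by norm_num) hg).neg h₁ hne₁ hlim₁ h₂ hne₂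
    hlim₂

lemma mul_cubicForm_pos_of_smul {m c : ℝ} (hm : c * m < 0) (hcubic : cubicForm g ξ (c • ℓ) < 0) :
    0 < m * cubicForm g ξ ℓ := by
  rw [cubicForm_smul] at hcubic
  have hprod : 0 < c ^ 4 * (m * cubicForm g ξ ℓ) :=
    (mul_pos_of_neg_of_neg hm hcubic).trans_eq (by ring)
  exact pos_of_mul_pos_right hprod (by positivity)

lemma mixedForm_mul_cubicForm_pos (h : SmoothCoercive T f) {τ : ℝ}
    (hτ : τ ∈ Ioo 0 T) (hξ : gradient (f τ) ξ = 0) (hpsd : (hessian (f τ) ξ).PosSemidef)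
    (hℓ : SpansKernel (f τ) ξ ℓ) (hmixed : mixedForm T f τ ξ ℓ ≠ 0)
    (hcubic : cubicForm (f τ) ξ ℓ ≠ 0) {u : ℝ → Rn n} (hu : Tendsto u (𝓝[<] τ) (𝓝 ξ))
    (hzero : ∀ᶠ t in 𝓝[<] τ, gradient (f t) (u t) = 0) :
    0 < mixedForm T f τ ξ ℓ * cubicForm (f τ) ξ ℓ := by
  have hτ' := Ioo_subset_Icc_self hτ
  have hd : DifferentiableAt ℝ (gradient (f τ)) ξ :=
    differentiable_gradient (h.contDiff_two hτ') ξ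
  obtain ⟨c, hc, hneg, _, _, _, _, hfold⟩ :=
    exists_smul_isFold_gradient (h.contDiff_three hτ') hξ hpsd hℓ hcubic
  have hker : fderiv ℝ (gradient (f τ)) ξ (c • ℓ) = 0 := by
    rw [← ContinuousLinearMap.coe_coe, ← LinearMap.mem_ker, (hℓ.smul hc).ker_fderiv_gradient hd]
    exact Submodule.mem_span_singleton_self _
  have hgrad := h.contDiffOn_gradient (hτ.1.trans hτ.2)
  have hstrict := (hgrad.contDiffAt (strip_mem_nhds hτ ξ)).hasStrictFDerivAt two_ne_zero
  have hspatial (v : Rn n) : fderiv ℝ (gradient (f τ)) ξ v =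
      fderiv ℝ (Function.uncurry fun t => gradient (f t)) (τ, ξ) (0, v) := by
    rw [fderiv_slice (G := fun t => gradient (f t)) two_ne_zero hgrad hτ',
      fderivWithin_of_mem_nhds (strip_mem_nhds hτ ξ)]
    simp
  have hnonpos := hfold.inner_timeDeriv_nonpos (F := fun t => gradient (f t)) hstrict
    (fun v => hspatial v ▸
      inner_apply_eq_zero ((isPositive_fderiv_gradient_iff hd).2 hpsd) hker v) hu hzero
  rw [← mixedForm_eq (h.1.of_le (by norm_num)) hτ, mixedForm_smul] at hnonpos
  exact mul_cubicForm_pos_of_smul (hnonpos.lt_of_ne (mul_ne_zero hc hmixed)) hneg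

end Critical

section Existence

variable {T a b : ℝ} {f : ℝ → Rn n → ℝ} {y₀ y ξ : Rn n} {u w : ℝ → Rn n} {k : ℕ} {t : ℕ → ℝ}
  {U : ℕ → ℝ → Rn n} {x : ℕ → Rn n} {v : ℕ → ℝ → Rn n}

/-- The conditions which `IsEvolution` imposes at a jump: at the time `b` the orbit `w` leads from
the degenerate critical point `ξ` to the point `y`. -/
structure IsJump (T : ℝ) (f : ℝ → Rn n → ℝ) (b : ℝ) (ξ : Rn n) (w : ℝ → Rn n) (y : Rn n) :
    Prop where
  degenerate : (b, ξ) ∈ degenerateSet T f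
  posSemidef : (hessian (f b) ξ).PosSemidef
  sameSign : ∃ ℓ, SpansKernel (f b) ξ ℓ ∧ 0 < mixedForm T f b ξ ℓ * cubicForm (f b) ξ ℓ
  flow : IsGradientFlow (f b) w
  atBot : Tendsto w atBot (𝓝 ξ)
  atTop : Tendsto w atTop (𝓝 y)

/-- Evolutions from an arbitrary initial time `a`, the form in which they can be built by induction
on the number of degenerate times still to come. The indexing is that of `IsEvolution`; the
regularity required there is automatic, see `IsEvolutionFrom.isEvolution`. -/
structure IsEvolutionFrom (T : ℝ) (f : ℝ → Rn n → ℝ) (a : ℝ) (y₀ : Rn n)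
    (k : ℕ) (t : ℕ → ℝ) (u : ℕ → ℝ → Rn n) (x : ℕ → Rn n) (v : ℕ → ℝ → Rn n) : Prop where
  pos : 0 < k
  t_zero : t 0 = a
  t_last : t k = T
  t_lt : ∀ i < k, t i < t (i + 1)
  u_init : u 0 a = y₀
  branch : ∀ i < k, IsBranch (fun s => gradient (f s)) (Ico (t i) (t (i + 1))) (u i)
  limit : ∀ i < k, Tendsto (u i) (𝓝[<] t (i + 1)) (𝓝 (x i))
  jump : ∀ i, i + 1 < k → IsJump T f (t (i + 1)) (x i) (v i) (u (i + 1) (t (i + 1)))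

lemma mem_Icc_of_forall_lt_succ (ht : ∀ i < k, t i < t (i + 1)) {i : ℕ} (hi : i ≤ k) :
    t i ∈ Icc (t 0) (t k) :=
  have hmono := (strictMonoOn_Iic_of_lt_succ ht).monotoneOn
  ⟨hmono (mem_Iic.2 k.zero_le) hi i.zero_le, hmono hi self_mem_Iic hi⟩

lemma IsEvolutionFrom.mem_Icc (h : IsEvolutionFrom T f a y₀ k t U x v) (ha : 0 ≤ a) {i : ℕ}
    (hi : i ≤ k) : t i ∈ Icc 0 T := by
  have hti := mem_Icc_of_forall_lt_succ h.t_lt hi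
  rw [h.t_zero, h.t_last] at hti
  exact ⟨ha.trans hti.1, hti.2⟩

lemma IsEvolutionFrom.Ico_subset (h : IsEvolutionFrom T f a y₀ k t U x v) (ha : 0 ≤ a) {i : ℕ}
    (hi : i < k) : Ico (t i) (t (i + 1)) ⊆ Icc 0 T := fun _ hs =>
  ⟨(h.mem_Icc ha hi.le).1.trans hs.1, hs.2.le.trans (h.mem_Icc ha hi).2⟩

lemma IsEvolution.isEvolutionFrom (hf : SmoothCoercive T f) (h : IsEvolution T f y₀ k t U x v) :
    IsEvolutionFrom T f 0 y₀ k t U x v where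
  pos := h.pos
  t_zero := h.t_zero
  t_last := h.t_last
  t_lt := h.t_lt
  u_init := h.u_init
  branch i hi :=
    { continuousOn := (h.u_contDiff i hi).continuousOn
      zero := h.u_critical i hi
      pos := fun s hs => by
        have hleft := mem_Icc_of_forall_lt_succ h.t_lt hi.le
        have hright := mem_Icc_of_forall_lt_succ h.t_lt hi
        rw [h.t_zero, h.t_last] at hleft hright
        exact (posDef_hessian_iff (hf.contDiff_two
          ⟨hleft.1.trans hs.1, hs.2.le.trans hright.2⟩)).1 (h.u_posDef i hi s hs) }
  limit := h.u_limit
  jump i hi := ⟨h.x_degenerate i hi, h.x_posSemidef i hi, h.x_sameSign i hi, h.v_flow i hi,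
    h.v_atBot i hi, h.v_atTop i hi⟩

lemma IsEvolutionFrom.isEvolution (hT : 0 < T) (hf : SmoothCoercive T f)
    (h : IsEvolutionFrom T f 0 y₀ k t U x v) : IsEvolution T f y₀ k t U x v where
  pos := h.pos
  t_zero := h.t_zero
  t_last := h.t_last
  t_lt := h.t_lt
  u_contDiff i hi := (h.branch i hi).contDiffOn hT (hf.contDiffOn_gradient hT)
    (h.Ico_subset le_rfl hi) (uniqueDiffOn_Ico _ _)
  v_contDiff i hi := contDiff_of_isIntegralCurve (m := 1)
    (hf.contDiff_gradient (h.mem_Icc le_rfl hi.le)).neg (h.jump i hi).flow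
  u_init := h.u_init
  u_critical i hi := (h.branch i hi).zero
  u_posDef i hi s hs := (posDef_hessian_iff (hf.contDiff_two (h.Ico_subset le_rfl hi hs))).2
    ((h.branch i hi).pos s hs)
  u_limit := h.limit
  x_degenerate i hi := (h.jump i hi).degenerate
  x_posSemidef i hi := (h.jump i hi).posSemidef
  x_sameSign i hi := (h.jump i hi).sameSign
  v_flow i hi := (h.jump i hi).flow
  v_atBot i hi := (h.jump i hi).atBot
  v_atTop i hi := (h.jump i hi).atTop

lemma exists_branch_to_degenerate (hT : 0 < T) (hf : SmoothCoercive T f)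
    (hinj : InjOn Prod.fst (degenerateSet T f)) (ha : a ∈ Ico 0 T)
    (hy₀ : gradient (f a) y₀ = 0) (hpos : (hessian (f a) y₀).PosDef) :
    ∃ b ∈ Ioc a T, ∃ u ξ, u a = y₀ ∧ IsBranch (fun s => gradient (f s)) (Ico a b) u ∧
      Tendsto u (𝓝[<] b) (𝓝 ξ) ∧ (hessian (f b) ξ).PosSemidef ∧
      (b < T → (b, ξ) ∈ degenerateSet T f) := by
  obtain ⟨R, hR⟩ := hf.exists_critical_subset_closedBall
  obtain ⟨b, hb, u, ξ, hua, hu, hlim, hξ, hnonneg, hnotPos⟩ :=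
    exists_maximal_branch hT (hf.contDiffOn_gradient hT) (isCompact_closedBall 0 R) hR
      (fun t ht => hf.countable_critical hinj ht) ha hy₀
      ((posDef_hessian_iff (hf.contDiff_two ⟨ha.1, ha.2.le⟩)).1 hpos)
  have hbT : b ∈ Icc 0 T := ⟨ha.1.trans hb.1.le, hb.2⟩
  have hpsd := posSemidef_hessian_of_inner_nonneg (hf.contDiff_two hbT) hnonneg
  refine ⟨b, hb, u, ξ, hua, hu, hlim, hpsd, fun hlt => ⟨⟨hbT, hξ⟩, ?_⟩⟩
  by_contra hdet
  exact hnotPos hlt ((posDef_hessian_iff (hf.contDiff_two hbT)).1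
    (hpsd.posDef_iff_det_ne_zero.2 hdet))

lemma exists_isJump (hf : SmoothCoercive T f) (hinj : InjOn Prod.fst (degenerateSet T f))
    (htrans : Transversal T f) (hends : HeteroclinicEndsNondegenerate T f) (hb : b ∈ Ioo 0 T)
    (hξ : (b, ξ) ∈ degenerateSet T f) (hpsd : (hessian (f b) ξ).PosSemidef)
    (hlim : Tendsto u (𝓝[<] b) (𝓝 ξ)) (hzero : ∀ᶠ s in 𝓝[<] b, gradient (f s) (u s) = 0) :
    ∃ w y, IsJump T f b ξ w y ∧ gradient (f b) y = 0 ∧ (hessian (f b) y).PosDef := by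
  have hb' := Ioo_subset_Icc_self hb
  obtain ⟨R, hR⟩ := hf.exists_inner_gradient_pos
  obtain ⟨ℓ, hℓ, hmixed, hcubic⟩ := htrans b ξ hξ hpsd
  have hsign := mixedForm_mul_cubicForm_pos hf hb hξ.1.2 hpsd hℓ hmixed hcubic hlim hzero
  obtain ⟨w, hw, hne, hbot, R', hR'⟩ := exists_isGradientFlow_of_degenerate
    (hf.contDiff_three hb') (hR b hb') hξ.1.2 hpsd hℓ hcubic
  obtain ⟨y, hy, htop⟩ := exists_critical_tendsto_atTop
    ((hf.contDiff_two hb').differentiable two_ne_zero) (hf.contDiff_gradient hb').continuous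
    (hf.countable_critical hinj hb') hw (isCompact_closedBall 0 R') hR'
  exact ⟨w, y, ⟨hξ, hpsd, ⟨ℓ, hℓ, hsign⟩, hw, hbot, htop⟩, hy,
    hends b ξ hξ hpsd ⟨ℓ, hℓ, hcubic⟩ w y hw hne hbot htop⟩

lemma isEvolutionFrom_one (haT : a < T) (hua : u a = y₀)
    (hu : IsBranch (fun s => gradient (f s)) (Ico a T) u) (hlim : Tendsto u (𝓝[<] T) (𝓝 ξ)) :
    IsEvolutionFrom T f a y₀ 1 (fun i => Nat.casesOn i a fun _ => T) (fun _ => u) (fun _ => ξ)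
      (fun _ _ => 0) := by
  refine ⟨one_pos, rfl, rfl, fun i hi => ?_, hua, fun i hi => ?_, fun i hi => ?_,
    fun i hi => by omega⟩ <;> obtain rfl : i = 0 := by omega
  exacts [haT, hu, hlim]

lemma IsEvolutionFrom.cons (hab : a < b) (hua : u a = y₀)
    (hu : IsBranch (fun s => gradient (f s)) (Ico a b) u) (hlim : Tendsto u (𝓝[<] b) (𝓝 ξ))
    (hw : IsJump T f b ξ w y) (h : IsEvolutionFrom T f b y k t U x v) :
    IsEvolutionFrom T f a y₀ (k + 1) (fun i => Nat.casesOn i a t) (fun i => Nat.casesOn i u U)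
      (fun i => Nat.casesOn i ξ x) (fun i => Nat.casesOn i w v) := by
  obtain ⟨-, rfl, hlast, hlt, rfl, hbranch, hlimit, hjump⟩ := h
  refine ⟨k.succ_pos, rfl, hlast, ?_, hua, ?_, ?_, ?_⟩ <;> rintro (_ | i) hi
  exacts [hab, hlt i (by omega), hu, hbranch i (by omega), hlim, hlimit i (by omega), hw,
    hjump i (by omega)]

theorem exists_isEvolutionFrom (hT : 0 < T) (hf : SmoothCoercive T f)
    (hfinite : (degenerateSet T f).Finite) (hinj : InjOn Prod.fst (degenerateSet T f))
    (htrans : Transversal T f) (hends : HeteroclinicEndsNondegenerate T f) (ha : a ∈ Ico 0 T)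
    (hy₀ : gradient (f a) y₀ = 0) (hpos : (hessian (f a) y₀).PosDef) :
    ∃ k t U x v, IsEvolutionFrom T f a y₀ k t U x v := by
  induction hN : {p ∈ degenerateSet T f | a < p.1}.ncard using Nat.strong_induction_on
    generalizing a y₀ with
  | _ N ih =>
    obtain ⟨b, hb, u, ξ, hua, hu, hlim, hpsd, hdeg⟩ :=
      exists_branch_to_degenerate hT hf hinj ha hy₀ hpos
    rcases hb.2.eq_or_lt with rfl | hbT
    · exact ⟨_, _, _, _, _, isEvolutionFrom_one hb.1 hua hu hlim⟩
    · have hzero : ∀ᶠ s in 𝓝[<] b, gradient (f s) (u s) = 0 :=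
        mem_of_superset (Ioo_mem_nhdsLT hb.1) fun s hs => hu.zero s ⟨hs.1.le, hs.2⟩
      obtain ⟨w, y, hw, hy, hyPos⟩ := exists_isJump hf hinj htrans hends
        ⟨ha.1.trans_lt hb.1, hbT⟩ (hdeg hbT) hpsd hlim hzero
      have hfewer : {p ∈ degenerateSet T f | b < p.1}.ncard < N := by
        rw [← hN]
        refine Set.ncard_lt_ncard ⟨fun p hp => ⟨hp.1, hb.1.trans hp.2⟩, fun hsub => ?_⟩
          (hfinite.subset (sep_subset _ _))
        exact lt_irrefl b (hsub (a := (b, ξ)) ⟨hw.degenerate, hb.1⟩).2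
      obtain ⟨k, t, U, x, v, h⟩ := ih _ hfewer ⟨ha.1.trans hb.1.le, hbT⟩ hy hyPos rfl
      exact ⟨_, _, _, _, _, h.cons hb.1 hua hu hlim hw⟩

end Existence

section Uniqueness

variable {T a b : ℝ} {f : ℝ → Rn n → ℝ} {y₀ y y' ξ : Rn n} {w w' : ℝ → Rn n} {k k' i : ℕ}
  {t t' : ℕ → ℝ} {u u' : ℕ → ℝ → Rn n} {x x' : ℕ → Rn n} {v v' : ℕ → ℝ → Rn n}

lemma IsJump.exists_ne (h : IsJump T f b ξ w y) (hy : (hessian (f b) y).PosDef) :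
    ∃ s, w s ≠ ξ := by
  by_contra! hw
  obtain rfl : ξ = y :=
    tendsto_nhds_unique (tendsto_const_nhds.congr fun s => (hw s).symm) h.atTop
  exact hy.det_pos.ne' h.degenerate.2

lemma IsJump.unique (hf : SmoothCoercive T f) (h : IsJump T f b ξ w y)
    (h' : IsJump T f b ξ w' y') (hy : (hessian (f b) y).PosDef)
    (hy' : (hessian (f b) y').PosDef) : (∃ c, ∀ s, w' s = w (s + c)) ∧ y' = y := by
  obtain ⟨ℓ, hℓ, hsign⟩ := h.sameSign
  obtain ⟨c, hc⟩ := IsGradientFlow.eq_comp_add_of_tendsto (hf.contDiff_three h.degenerate.1.1)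
    h.degenerate.1.2 h.posSemidef hℓ (right_ne_zero_of_mul hsign.ne') h'.flow (h'.exists_ne hy')
    h'.atBot h.flow (h.exists_ne hy) h.atBot
  refine ⟨⟨c, hc⟩, tendsto_nhds_unique h'.atTop ?_⟩
  exact (h.atTop.comp (tendsto_atTop_add_const_right _ c tendsto_id)).congr fun s => (hc s).symm

lemma IsEvolutionFrom.posDef (hf : SmoothCoercive T f) (ha : 0 ≤ a)
    (h : IsEvolutionFrom T f a y₀ k t u x v) (hi : i < k) {s : ℝ}
    (hs : s ∈ Ico (t i) (t (i + 1))) : (hessian (f s) (u i s)).PosDef :=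
  (posDef_hessian_iff (hf.contDiff_two (h.Ico_subset ha hi hs))).2 ((h.branch i hi).pos s hs)

/-- The `i`-th branches of two evolutions exist and start at the same time from the same point. -/
structure HaveSameStart (k k' : ℕ) (t t' : ℕ → ℝ) (u u' : ℕ → ℝ → Rn n) (i : ℕ) : Prop where
  lt : i < k
  lt' : i < k'
  time_eq : t' i = t i
  point_eq : u' i (t i) = u i (t i)

lemma HaveSameStart.symm (hs : HaveSameStart k k' t t' u u' i) :
    HaveSameStart k' k t' t u' u i :=
  ⟨hs.lt', hs.lt, hs.time_eq.symm, hs.time_eq ▸ hs.point_eq.symm⟩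

lemma IsEvolutionFrom.eqOn_branch_of_le (hT : 0 < T) (hf : SmoothCoercive T f) (ha : 0 ≤ a)
    (h : IsEvolutionFrom T f a y₀ k t u x v) (h' : IsEvolutionFrom T f a y₀ k' t' u' x' v')
    (hs : HaveSameStart k k' t t' u u' i) (hle : t (i + 1) ≤ t' (i + 1)) :
    EqOn (u' i) (u i) (Ico (t i) (t (i + 1))) :=
  IsBranch.eqOn hT (hf.contDiffOn_gradient hT) (h.Ico_subset ha hs.lt) isPreconnected_Ico
    ((h'.branch i hs.lt').mono (Ico_subset_Ico hs.time_eq.le hle)) (h.branch i hs.lt)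
    (left_mem_Ico.2 (h.t_lt i hs.lt)) hs.point_eq

lemma IsEvolutionFrom.tendsto_of_eqOn (h : IsEvolutionFrom T f a y₀ k t u x v) (hi : i < k)
    (heq : EqOn (u' i) (u i) (Ico (t i) (t (i + 1)))) :
    Tendsto (u' i) (𝓝[<] t (i + 1)) (𝓝 (x i)) :=
  (h.limit i hi).congr' <| mem_of_superset (Ioo_mem_nhdsLT (h.t_lt i hi))
    fun _ hs => (heq ⟨hs.1.le, hs.2⟩).symm

lemma IsEvolutionFrom.time_succ_le (hT : 0 < T) (hf : SmoothCoercive T f) (ha : 0 ≤ a)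
    (h : IsEvolutionFrom T f a y₀ k t u x v) (h' : IsEvolutionFrom T f a y₀ k' t' u' x' v')
    (hs : HaveSameStart k k' t t' u u' i) : t' (i + 1) ≤ t (i + 1) := by
  by_contra! hlt
  have hik : i + 1 < k := by
    refine hs.lt.succ_le.lt_of_ne fun hk : i + 1 = k => ?_
    rw [hk, h.t_last, ← hk] at hlt
    exact hlt.not_ge (h'.mem_Icc ha hs.lt').2
  have hmem : t (i + 1) ∈ Ico (t' i) (t' (i + 1)) := ⟨hs.time_eq ▸ (h.t_lt i hs.lt).le, hlt⟩
  have hcont : Tendsto (u' i) (𝓝[<] t (i + 1)) (𝓝 (u' i (t (i + 1)))) := by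
    rw [← nhdsWithin_Ico_eq_nhdsLT (h.t_lt i hs.lt), ← hs.time_eq]
    exact ((h'.branch i hs.lt').continuousOn _ hmem).mono_left
      (nhdsWithin_mono _ (Ico_subset_Ico_right hlt.le))
  have hx : u' i (t (i + 1)) = x i := tendsto_nhds_unique hcont
    (h.tendsto_of_eqOn hs.lt (h.eqOn_branch_of_le hT hf ha h' hs hlt.le))
  exact (hx ▸ h'.posDef hf ha hs.lt' hmem).det_pos.ne' (h.jump i hik).degenerate.2

lemma IsEvolutionFrom.time_succ_eq (hT : 0 < T) (hf : SmoothCoercive T f) (ha : 0 ≤ a)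
    (h : IsEvolutionFrom T f a y₀ k t u x v) (h' : IsEvolutionFrom T f a y₀ k' t' u' x' v')
    (hs : HaveSameStart k k' t t' u u' i) : t' (i + 1) = t (i + 1) :=
  (h.time_succ_le hT hf ha h' hs).antisymm (h'.time_succ_le hT hf ha h hs.symm)

lemma IsEvolutionFrom.limit_eq (hT : 0 < T) (hf : SmoothCoercive T f) (ha : 0 ≤ a)
    (h : IsEvolutionFrom T f a y₀ k t u x v) (h' : IsEvolutionFrom T f a y₀ k' t' u' x' v')
    (hs : HaveSameStart k k' t t' u u' i) : x' i = x i := by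
  have htime := h.time_succ_eq hT hf ha h' hs
  exact tendsto_nhds_unique (htime ▸ h'.limit i hs.lt')
    (h.tendsto_of_eqOn hs.lt (h.eqOn_branch_of_le hT hf ha h' hs htime.ge))

lemma IsEvolutionFrom.lt_length (h : IsEvolutionFrom T f a y₀ k t u x v) (ha : 0 ≤ a)
    (h' : IsEvolutionFrom T f a y₀ k' t' u' x' v') (hi : i < k) (hi' : i ≤ k')
    (ht : t' i = t i) : i < k' := by
  refine hi'.lt_of_ne ?_
  rintro rfl
  have hlt := h.t_lt i hi
  rw [← ht, h'.t_last] at hlt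
  exact hlt.not_ge (h.mem_Icc ha hi).2

lemma IsEvolutionFrom.jump_eq (hT : 0 < T) (hf : SmoothCoercive T f) (ha : 0 ≤ a)
    (h : IsEvolutionFrom T f a y₀ k t u x v) (h' : IsEvolutionFrom T f a y₀ k' t' u' x' v')
    (hs : HaveSameStart k k' t t' u u' i) (hi : i + 1 < k) :
    (∃ c, ∀ s, v' i s = v i (s + c)) ∧ HaveSameStart k k' t t' u u' (i + 1) := by
  have htime := h.time_succ_eq hT hf ha h' hs
  have hi' := h.lt_length ha h' hi hs.lt' htime
  have hjump' := h'.jump i hi'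
  have hpos' := h'.posDef hf ha hi' (left_mem_Ico.2 (h'.t_lt _ hi'))
  rw [htime, h.limit_eq hT hf ha h' hs] at hjump'
  rw [htime] at hpos'
  obtain ⟨hv, hpoint⟩ := (h.jump i hi).unique hf hjump'
    (h.posDef hf ha hi (left_mem_Ico.2 (h.t_lt _ hi))) hpos'
  exact ⟨hv, hi, hi', htime, hpoint⟩

lemma IsEvolutionFrom.haveSameStart (hT : 0 < T) (hf : SmoothCoercive T f) (ha : 0 ≤ a)
    (h : IsEvolutionFrom T f a y₀ k t u x v) (h' : IsEvolutionFrom T f a y₀ k' t' u' x' v')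
    (hi : i < k) : HaveSameStart k k' t t' u u' i := by
  induction i with
  | zero => exact ⟨hi, h'.pos, h'.t_zero.trans h.t_zero.symm,
      by rw [h.t_zero, h.u_init, h'.u_init]⟩
  | succ i ih => exact (h.jump_eq hT hf ha h' (ih (by omega)) hi).2

lemma IsEvolutionFrom.time_eq (hT : 0 < T) (hf : SmoothCoercive T f) (ha : 0 ≤ a)
    (h : IsEvolutionFrom T f a y₀ k t u x v) (h' : IsEvolutionFrom T f a y₀ k' t' u' x' v')
    (hi : i ≤ k) : t' i = t i := by
  rcases i with _ | i
  · exact h'.t_zero.trans h.t_zero.symm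
  · exact h.time_succ_eq hT hf ha h' (h.haveSameStart hT hf ha h' hi)

lemma IsEvolutionFrom.length_le (hT : 0 < T) (hf : SmoothCoercive T f) (ha : 0 ≤ a)
    (h : IsEvolutionFrom T f a y₀ k t u x v) (h' : IsEvolutionFrom T f a y₀ k' t' u' x' v') :
    k ≤ k' := by
  by_contra! hlt
  exact (h.haveSameStart hT hf ha h' hlt).lt'.false

theorem IsEvolutionFrom.unique (hT : 0 < T) (hf : SmoothCoercive T f) (ha : 0 ≤ a)
    (h : IsEvolutionFrom T f a y₀ k t u x v) (h' : IsEvolutionFrom T f a y₀ k' t' u' x' v') :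
    k' = k ∧ (∀ i ≤ k, t' i = t i) ∧ (∀ i < k, EqOn (u' i) (u i) (Ico (t i) (t (i + 1)))) ∧
      (∀ i < k, x' i = x i) ∧ ∀ i, i + 1 < k → ∃ c : ℝ, ∀ s, v' i s = v i (s + c) := by
  have hstart := fun i (hi : i < k) => h.haveSameStart hT hf ha h' hi
  exact ⟨(h'.length_le hT hf ha h).antisymm (h.length_le hT hf ha h'),
    fun i hi => h.time_eq hT hf ha h' hi,
    fun i hi => h.eqOn_branch_of_le hT hf ha h' (hstart i hi)
      (h.time_succ_eq hT hf ha h' (hstart i hi)).ge,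
    fun i hi => h.limit_eq hT hf ha h' (hstart i hi),
    fun i hi => (h.jump_eq hT hf ha h' (hstart i (by omega)) hi).1⟩

end Uniqueness

end GradFlow

end

theorem mainTheorem3 (n : ℕ) (T : ℝ) (hT : 0 < T) (f : ℝ → GradFlow.Rn n → ℝ)
    (h₁ : GradFlow.SmoothCoercive T f)
    (h₂ : GradFlow.FinitelyDegenerate T f)
    (h₃ : GradFlow.Transversal T f)
    (h₄ : GradFlow.HeteroclinicEndsNondegenerate T f)
    (y₀ : GradFlow.Rn n) (hy₀ : gradient (f 0) y₀ = 0)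
    (hy₀' : (GradFlow.hessian (f 0) y₀).PosDef) :
    ∃ (k : ℕ) (t : ℕ → ℝ) (u : ℕ → ℝ → GradFlow.Rn n) (x : ℕ → GradFlow.Rn n)
      (v : ℕ → ℝ → GradFlow.Rn n),
      GradFlow.IsEvolution T f y₀ k t u x v ∧
      ∀ (k' : ℕ) (t' : ℕ → ℝ) (u' : ℕ → ℝ → GradFlow.Rn n) (x' : ℕ → GradFlow.Rn n)
        (v' : ℕ → ℝ → GradFlow.Rn n),
        GradFlow.IsEvolution T f y₀ k' t' u' x' v' →
        k' = k ∧
        (∀ i ≤ k, t' i = t i) ∧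
        (∀ i < k, Set.EqOn (u' i) (u i) (Set.Ico (t i) (t (i + 1)))) ∧
        (∀ i < k, x' i = x i) ∧
        (∀ i, i + 1 < k → ∃ c : ℝ, ∀ s, v' i s = v i (s + c)) := by
  obtain ⟨k, t, u, x, v, h⟩ := GradFlow.exists_isEvolutionFrom hT h₁ h₂.1 h₂.2.1 h₃ h₄
    (Set.left_mem_Ico.2 hT) hy₀ hy₀'
  exact ⟨k, t, u, x, v, h.isEvolution hT h₁, fun k' t' u' x' v' h' =>
    h.unique hT h₁ le_rfl (h'.isEvolutionFrom h₁)⟩
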